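/- Notation. Write $\xi=\xi_1+i\xi_2\in\mathbb{C}$, $\partial_\pm=\tfrac12(\partial_{\xi_1}\mp i\,\partial_{\xi_2})$, $d\xi_\pm=d\xi_1\pm i\,d\xi_2$, $[A,B]=AB-BA$, and $(A,B)=-\tfrac12\operatorname{tr}(AB)$ for $A,B\in\mathbb{C}^{N\times N}$; "orthogonal" refers to this bilinear form. A *finite-action solution* of the $\mathbb{C}P^{N-1}$ sigma model is a map $P:\mathbb{C}\to\mathbb{C}^{N\times N}$ such that $P(\xi)^2=P(\xi)=P(\xi)^\dagger$ and $\operatorname{tr}P(\xi)=1$ for all $\xi$, $P$ is of class $C^{N+2}$ on the extended plane (both $P$ and $w\mapsto P(1/w)$, the latter extended to $w=0$, are $C^{N+2}$), $[\partial_+\partial_-P,P]=0$, and the Lagrangian density $L=\operatorname{tr}(\partial_+P\,\partial_-P)$ is integrable over $\mathbb{R}^2$. The raising and lowering operators are $$\Pi_\pm X=\frac{\partial_\pm X\,X\,\partial_\mp X}{\operatorname{tr}(\partial_\pm X\,X\,\partial_\mp X)},$$ extended by continuity to those zeros of $\partial_\pm X\,X\,\partial_\mp X$ that are limits of non-zeros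 at which the quotient has a limit, and equal to $0$ at all other zeros (so $\Pi_\pm X=0$ if $\partial_\pm X\,X\,\partial_\mp X\equiv0$). The sequence $\Lambda$ of $P$ consists of the nonzero $\Pi_+^jP_0$, $j\ge0$, where $P_0$ is a finite-action solution projecting onto the direction of a nowhere vanishing holomorphic vector $f:\mathbb{C}\to\mathbb{C}^N$ and $\Pi_+^nP_0=P$ for some $n\ge0$. Let $P$ be a finite-action solution and $F:\mathbb{C}\to su(N)$ a surface associated with it, i.e. $dF=i\left(-[\partial_+P,P]\,d\xi_++[\partial_-P,P]\,d\xi_-\right)$. Put $N_{+-}=\partial_+\partial_-F$ and, at the points where $L\neq0$, $$N_{++}=\partial_+^2F-\frac{\partial_+L}{L}\,\partial_+F,\qquad N_{--}=\partial_-^2F-\frac{\partial_-L}{L}\,\partial_-F,\qquad H=\frac1L\left(\partial_{\xi_1}^2F+\partial_{\xi_2}^2F\right).$$ Then the following hold. 1. $N_{+-}$ is orthogonal to both tangent vectors $\partial_+F$ and $\partial_-F$ at every point. At every point where $L\ne0$, each of $N_{++}$, $N_{--}$ and $H=\tfrac4L N_{+-}$ is orthogonal to $\partial_+F$ and to $\partial_-F$,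 and $N_{++}$ and $N_{--}$ are orthogonal to $N_{+-}$. 2. Let $Q$ be any element of $\Lambda$, or any of $\Pi_+^kP$, $\Pi_-^kP$ with $k\ge0$. Then $Q$ is orthogonal to the surface: $(Q,\partial_+F)=(Q,\partial_-F)=0$ at every point. Moreover $(N_{++},Q)=(N_{--},Q)=0$ at every point where $L\neq0$. -/

import Mathlib

open scoped Matrix.Norms.L2Operator Topology

noncomputable section

namespace CPModel

/-- Complex `N × N` matrices; the operator norm opened above only supplies the (norm independent)
notions of derivative and limit. -/
abbrev Mat (N : ℕ) := Matrix (Fin N) (Fin N) ℂ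

section Derivatives

variable {E : Type*} [NormedAddCommGroup E] [NormedSpace ℂ E]

/-- `∂₁ = ∂/∂ξ₁`, where `ξ = ξ₁ + i ξ₂`. -/
def d1 (f : ℂ → E) (ξ : ℂ) : E := fderiv ℝ f ξ 1

/-- `∂₂ = ∂/∂ξ₂`, where `ξ = ξ₁ + i ξ₂`. -/
def d2 (f : ℂ → E) (ξ : ℂ) : E := fderiv ℝ f ξ Complex.I

/-- `∂₊ = (∂₁ - i ∂₂) / 2`. -/
def dPlus (f : ℂ → E) (ξ : ℂ) : E := (1 / 2 : ℂ) • (d1 f ξ - Complex.I • d2 f ξ)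

/-- `∂₋ = (∂₁ + i ∂₂) / 2`. -/
def dMinus (f : ℂ → E) (ξ : ℂ) : E := (1 / 2 : ℂ) • (d1 f ξ + Complex.I • d2 f ξ)

end Derivatives

variable {N : ℕ}

/-- The commutator `[A, B] = A B - B A`. -/
def comm (A B : Mat N) : Mat N := A * B - B * A

/-- Rank-1 Hermitian projectors. -/
def IsRankOneProjector (A : Mat N) : Prop :=
  A * A = A ∧ A.conjTranspose = A ∧ A.trace = 1

/-- The Lagrangian density `L(P) = tr(∂₊P ∂₋P)`. -/
def lagrangian (P : ℂ → Mat N) (ξ : ℂ) : ℂ := (dPlus P ξ * dMinus P ξ).trace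

/-- A finite-action solution of the `ℂP^(N-1)` sigma model on the extended complex plane.
The function `R` is the inversion of `P`; that it is defined and regular at `0` says that `P` is
regular at infinity. -/
structure IsFiniteActionSolution (P : ℂ → Mat N) : Prop where
  isProjector : ∀ ξ, IsRankOneProjector (P ξ)
  contDiff : ContDiff ℝ (N + 2 : ℕ) P
  contDiff_at_infty : ∃ R : ℂ → Mat N, ContDiff ℝ (N + 2 : ℕ) R ∧ ∀ w, w ≠ 0 → R w = P w⁻¹
  euler_lagrange : ∀ ξ, comm (dPlus (dMinus P) ξ) (P ξ) = 0
  finite_action : MeasureTheory.Integrable (lagrangian P)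

open Classical in
/-- The quotient `M / tr M`, extended by continuity to the zeros of `M` that lie in the closure of
`{M ≠ 0}`, and equal to `0` at the remaining zeros of `M` (in particular identically `0` if `M` is).
At a zero of `M` where there is no limit the value is `0` as well. -/
def traceQuotient (M : ℂ → Mat N) (ξ : ℂ) : Mat N :=
  if M ξ ≠ 0 then (M ξ).trace⁻¹ • M ξ
  else if ξ ∈ closure {η | M η ≠ 0} ∧
      ∃ l, Filter.Tendsto (fun η => (M η).trace⁻¹ • M η) (𝓝[{η | M η ≠ 0}] ξ) (𝓝 l) then
    extendFrom {η | M η ≠ 0} (fun η => (M η).trace⁻¹ • M η) ξ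
  else 0

/-- The raising operator `Π₊ X = ∂₊X X ∂₋X / tr(∂₊X X ∂₋X)`. -/
def raising (X : ℂ → Mat N) : ℂ → Mat N :=
  traceQuotient fun ξ => dPlus X ξ * X ξ * dMinus X ξ

/-- The lowering operator `Π₋ X = ∂₋X X ∂₊X / tr(∂₋X X ∂₊X)`. -/
def lowering (X : ℂ → Mat N) : ℂ → Mat N :=
  traceQuotient fun ξ => dMinus X ξ * X ξ * dPlus X ξ

/-- The projector field `X` projects onto the direction of a holomorphic vector. -/
def IsHolomorphicProjector (X : ℂ → Mat N) : Prop :=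
  (∀ ξ, IsRankOneProjector (X ξ)) ∧
    ∃ f : ℂ → (Fin N → ℂ), Differentiable ℂ f ∧ ∀ ξ, f ξ ≠ 0 ∧ (X ξ).mulVec (f ξ) = f ξ

/-- The sequence `Λ = {P₀, Π₊P₀, Π₊²P₀, …}` of the nonzero projectors generated by a holomorphic
finite-action solution `P₀` with `Π₊ⁿ P₀ = P` for some `n`. -/
def projectorSequence (P : ℂ → Mat N) : Set (ℂ → Mat N) :=
  {Q | ∃ (P₀ : ℂ → Mat N) (n j : ℕ), IsFiniteActionSolution P₀ ∧ IsHolomorphicProjector P₀ ∧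
    raising^[n] P₀ = P ∧ raising^[j] P₀ = Q ∧ Q ≠ 0}

/-- `F` is a surface in `su(N)` associated with `P`, that is, an integral of
`dF = i (-[∂₊P, P] dξ₊ + [∂₋P, P] dξ₋)`. -/
structure IsSurface (P F : ℂ → Mat N) : Prop where
  differentiable : Differentiable ℝ F
  dPlus_eq : ∀ ξ, dPlus F ξ = -Complex.I • comm (dPlus P ξ) (P ξ)
  dMinus_eq : ∀ ξ, dMinus F ξ = Complex.I • comm (dMinus P ξ) (P ξ)
  skewHermitian : ∀ ξ, (F ξ).conjTranspose = -F ξ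
  traceless : ∀ ξ, (F ξ).trace = 0

/-- The trace form `(A, B) = -tr(A B) / 2`. -/
def form (A B : Mat N) : ℂ := -(1 / 2 : ℂ) * (A * B).trace

/-- The Christoffel symbol `Γ⁺₊₊ = ∂₊L / L`. -/
def christoffelPlus (P : ℂ → Mat N) (ξ : ℂ) : ℂ := dPlus (lagrangian P) ξ / lagrangian P ξ

/-- The Christoffel symbol `Γ⁻₋₋ = ∂₋L / L`. -/
def christoffelMinus (P : ℂ → Mat N) (ξ : ℂ) : ℂ := dMinus (lagrangian P) ξ / lagrangian P ξ

/-- The normal `N₊₊ = ∂₊∂₊F - Γ⁺₊₊ ∂₊F`. -/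
def normalPP (P F : ℂ → Mat N) (ξ : ℂ) : Mat N :=
  dPlus (dPlus F) ξ - christoffelPlus P ξ • dPlus F ξ

/-- The normal `N₊₋ = ∂₊∂₋F`. -/
def normalPM (F : ℂ → Mat N) (ξ : ℂ) : Mat N := dPlus (dMinus F) ξ

/-- The normal `N₋₋ = ∂₋∂₋F - Γ⁻₋₋ ∂₋F`. -/
def normalMM (P F : ℂ → Mat N) (ξ : ℂ) : Mat N :=
  dMinus (dMinus F) ξ - christoffelMinus P ξ • dMinus F ξ

/-- The mean curvature vector `H = (∂₁∂₁F + ∂₂∂₂F) / L`. -/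
def meanCurvature (P F : ℂ → Mat N) (ξ : ℂ) : Mat N :=
  (lagrangian P ξ)⁻¹ • (d1 (d1 F) ξ + d2 (d2 F) ξ)

end CPModel

end

noncomputable section

namespace CPModel

/-! ### Wirtinger calculus. -/

section Calculus

variable {E : Type*} [NormedAddCommGroup E] [NormedSpace ℂ E]
variable {G : Type*} [NormedAddCommGroup G] [NormedSpace ℂ G]

/-! The tangent vectors `∂₊F = [-i ∂₊P, P]` and `∂₋F = [i ∂₋P, P]` are commutators with `P`, and so
are `N₊₊` and `N₋₋`. As `tr([A, P] C) = tr(A [P, C])`, whatever commutes with `P` is orthogonal to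
all four. `N₊₋` commutes with `P`, because harmonicity leaves in it only products of two matrices
that are off-diagonal with respect to `P`. That `N₊₊` and `N₋₋` are normal follows by
differentiating the conformal metric `tr(∂₊F ∂₊F) = tr(∂₋F ∂₋F) = 0`, `tr(∂₊F ∂₋F) = -L`.

The real work is to show that every `Q` commutes with `P`. It rests on the higher isotropy of
harmonic spheres (`isotropy`): `∂₊P P` is orthogonal to the jets `∇₋ᵐP`, `m ≤ N + 1`. By induction
on `m` the trace pairing of the two is holomorphic, thanks to the curvature identity and
harmonicity, and it tends to zero at infinity, so Liouville's theorem kills it. Orthogonality to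
jets then passes through the raising operator pointwise (`raising_mul_eq_zero`), without any
regularity of the iterates, at the cost of one jet order per step. Iterates beyond the `N`-th
vanish, since otherwise the Frenet equations (`FrenetOn`) would produce `N + 1` mutually orthogonal
rank-one projectors. Transposition exchanges raising and lowering. For members of `Λ` that precede
`P`, the Frenet equations give orthogonality on a dense set; continuity extends it for `P₀`, and
raising carries it upwards from there. -/

theorem dPlus_eq_fderiv (f : ℂ → E) (ξ : ℂ) :
    dPlus f ξ = (1 / 2 : ℂ) • (fderiv ℝ f ξ 1 - Complex.I • fderiv ℝ f ξ Complex.I) := rfl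

theorem dMinus_eq_fderiv (f : ℂ → E) (ξ : ℂ) :
    dMinus f ξ = (1 / 2 : ℂ) • (fderiv ℝ f ξ 1 + Complex.I • fderiv ℝ f ξ Complex.I) := rfl

theorem dPlus_congr {f g : ℂ → E} {ξ : ℂ} (h : f =ᶠ[𝓝 ξ] g) : dPlus f ξ = dPlus g ξ := by
  simp only [dPlus_eq_fderiv, h.fderiv_eq]

theorem dMinus_congr {f g : ℂ → E} {ξ : ℂ} (h : f =ᶠ[𝓝 ξ] g) : dMinus f ξ = dMinus g ξ := by
  simp only [dMinus_eq_fderiv, h.fderiv_eq]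

/-- The default value of `fderiv` makes the numerator of the raising operator vanish where its
argument is not differentiable; this is why irregular iterates cause no trouble later. -/
theorem dPlus_eq_zero_of_not_differentiableAt {f : ℂ → E} {ξ : ℂ}
    (h : ¬ DifferentiableAt ℝ f ξ) : dPlus f ξ = 0 := by
  simp [dPlus_eq_fderiv, fderiv_zero_of_not_differentiableAt h]

theorem dMinus_eq_zero_of_not_differentiableAt {f : ℂ → E} {ξ : ℂ}
    (h : ¬ DifferentiableAt ℝ f ξ) : dMinus f ξ = 0 := by
  simp [dMinus_eq_fderiv, fderiv_zero_of_not_differentiableAt h]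

@[simp] theorem dPlus_const (c : E) (ξ : ℂ) : dPlus (fun _ => c) ξ = 0 := by
  simp [dPlus_eq_fderiv]

@[simp] theorem dMinus_const (c : E) (ξ : ℂ) : dMinus (fun _ => c) ξ = 0 := by
  simp [dMinus_eq_fderiv]

theorem dPlus_add {f g : ℂ → E} {ξ : ℂ} (hf : DifferentiableAt ℝ f ξ)
    (hg : DifferentiableAt ℝ g ξ) :
    dPlus (fun η => f η + g η) ξ = dPlus f ξ + dPlus g ξ := by
  simp only [dPlus_eq_fderiv, fderiv_fun_add hf hg, add_apply]
  module

theorem dMinus_add {f g : ℂ → E} {ξ : ℂ} (hf : DifferentiableAt ℝ f ξ)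
    (hg : DifferentiableAt ℝ g ξ) :
    dMinus (fun η => f η + g η) ξ = dMinus f ξ + dMinus g ξ := by
  simp only [dMinus_eq_fderiv, fderiv_fun_add hf hg, add_apply]
  module

theorem dPlus_sub {f g : ℂ → E} {ξ : ℂ} (hf : DifferentiableAt ℝ f ξ)
    (hg : DifferentiableAt ℝ g ξ) :
    dPlus (fun η => f η - g η) ξ = dPlus f ξ - dPlus g ξ := by
  simp only [dPlus_eq_fderiv, fderiv_fun_sub hf hg, sub_apply]
  module

theorem dMinus_sub {f g : ℂ → E} {ξ : ℂ} (hf : DifferentiableAt ℝ f ξ)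
    (hg : DifferentiableAt ℝ g ξ) :
    dMinus (fun η => f η - g η) ξ = dMinus f ξ - dMinus g ξ := by
  simp only [dMinus_eq_fderiv, fderiv_fun_sub hf hg, sub_apply]
  module

theorem dMinus_sum {ι : Type*} (s : Finset ι) {f : ι → ℂ → E} {ξ : ℂ}
    (hf : ∀ i ∈ s, DifferentiableAt ℝ (f i) ξ) :
    dMinus (fun η => ∑ i ∈ s, f i η) ξ = ∑ i ∈ s, dMinus (f i) ξ := by
  simp only [dMinus_eq_fderiv, fderiv_fun_sum hf, sum_apply, Finset.smul_sum,
    ← Finset.sum_add_distrib]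

theorem dPlus_smul {c : ℂ → ℂ} {f : ℂ → E} {ξ : ℂ} (hc : DifferentiableAt ℝ c ξ)
    (hf : DifferentiableAt ℝ f ξ) :
    dPlus (fun η => c η • f η) ξ = c ξ • dPlus f ξ + dPlus c ξ • f ξ := by
  simp only [dPlus_eq_fderiv, fderiv_fun_smul hc hf, add_apply,
    smul_apply, ContinuousLinearMap.smulRight_apply, smul_eq_mul]
  module

theorem dMinus_smul {c : ℂ → ℂ} {f : ℂ → E} {ξ : ℂ} (hc : DifferentiableAt ℝ c ξ)
    (hf : DifferentiableAt ℝ f ξ) :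
    dMinus (fun η => c η • f η) ξ = c ξ • dMinus f ξ + dMinus c ξ • f ξ := by
  simp only [dMinus_eq_fderiv, fderiv_fun_smul hc hf, add_apply,
    smul_apply, ContinuousLinearMap.smulRight_apply, smul_eq_mul]
  module

theorem dPlus_const_smul (c : ℂ) {f : ℂ → E} {ξ : ℂ} (hf : DifferentiableAt ℝ f ξ) :
    dPlus (fun η => c • f η) ξ = c • dPlus f ξ := by
  rw [dPlus_smul (differentiableAt_const c) hf]; simp

theorem dMinus_const_smul (c : ℂ) {f : ℂ → E} {ξ : ℂ} (hf : DifferentiableAt ℝ f ξ) :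
    dMinus (fun η => c • f η) ξ = c • dMinus f ξ := by
  rw [dMinus_smul (differentiableAt_const c) hf]; simp

theorem dPlus_clm_comp (T : E →L[ℂ] G) {f : ℂ → E} {ξ : ℂ} (hf : DifferentiableAt ℝ f ξ) :
    dPlus (fun η => T (f η)) ξ = T (dPlus f ξ) := by
  have h : fderiv ℝ (fun η => T (f η)) ξ = (T.restrictScalars ℝ).comp (fderiv ℝ f ξ) :=
    ((T.restrictScalars ℝ).hasFDerivAt.comp ξ hf.hasFDerivAt).fderiv
  simp [dPlus_eq_fderiv, h]

theorem dMinus_clm_comp (T : E →L[ℂ] G) {f : ℂ → E} {ξ : ℂ} (hf : DifferentiableAt ℝ f ξ) :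
    dMinus (fun η => T (f η)) ξ = T (dMinus f ξ) := by
  have h : fderiv ℝ (fun η => T (f η)) ξ = (T.restrictScalars ℝ).comp (fderiv ℝ f ξ) :=
    ((T.restrictScalars ℝ).hasFDerivAt.comp ξ hf.hasFDerivAt).fderiv
  simp [dMinus_eq_fderiv, h]

theorem dPlus_mul {A : Type*} [NormedRing A] [NormedAlgebra ℂ A] {f g : ℂ → A} {ξ : ℂ}
    (hf : DifferentiableAt ℝ f ξ) (hg : DifferentiableAt ℝ g ξ) :
    dPlus (fun η => f η * g η) ξ = dPlus f ξ * g ξ + f ξ * dPlus g ξ := by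
  have h : fderiv ℝ (fun η => f η * g η) ξ = _ := (hf.hasFDerivAt.mul' hg.hasFDerivAt).fderiv
  simp only [dPlus_eq_fderiv, h, add_apply,
    smul_apply, smul_eq_mul, op_smul_eq_mul, smul_mul_assoc,
    mul_smul_comm, sub_mul, mul_sub, smul_add, smul_sub]
  abel

theorem dMinus_mul {A : Type*} [NormedRing A] [NormedAlgebra ℂ A] {f g : ℂ → A} {ξ : ℂ}
    (hf : DifferentiableAt ℝ f ξ) (hg : DifferentiableAt ℝ g ξ) :
    dMinus (fun η => f η * g η) ξ = dMinus f ξ * g ξ + f ξ * dMinus g ξ := by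
  have h : fderiv ℝ (fun η => f η * g η) ξ = _ := (hf.hasFDerivAt.mul' hg.hasFDerivAt).fderiv
  simp only [dMinus_eq_fderiv, h, add_apply,
    smul_apply, smul_eq_mul, op_smul_eq_mul, smul_mul_assoc,
    mul_smul_comm, add_mul, mul_add, smul_add]
  abel

theorem contDiffAt_dPlus {f : ℂ → E} {ξ : ℂ} {m n : ℕ} (hf : ContDiffAt ℝ n f ξ) (h : m + 1 ≤ n) :
    ContDiffAt ℝ m (dPlus f) ξ := by
  have h1 : ContDiffAt ℝ m (fderiv ℝ f) ξ := hf.fderiv_right (by exact_mod_cast h)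
  have h2 (v : ℂ) : ContDiffAt ℝ m (fun η => fderiv ℝ f η v) ξ := h1.clm_apply contDiffAt_const
  exact (((h2 1).sub ((h2 Complex.I).const_smul Complex.I)).const_smul (1 / 2 : ℂ))

theorem contDiffAt_dMinus {f : ℂ → E} {ξ : ℂ} {m n : ℕ} (hf : ContDiffAt ℝ n f ξ) (h : m + 1 ≤ n) :
    ContDiffAt ℝ m (dMinus f) ξ := by
  have h1 : ContDiffAt ℝ m (fderiv ℝ f) ξ := hf.fderiv_right (by exact_mod_cast h)
  have h2 (v : ℂ) : ContDiffAt ℝ m (fun η => fderiv ℝ f η v) ξ := h1.clm_apply contDiffAt_const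
  exact (((h2 1).add ((h2 Complex.I).const_smul Complex.I)).const_smul (1 / 2 : ℂ))

theorem contDiff_dPlus {f : ℂ → E} {m n : ℕ} (hf : ContDiff ℝ n f) (h : m + 1 ≤ n) :
    ContDiff ℝ m (dPlus f) :=
  contDiff_iff_contDiffAt.2 fun _ => contDiffAt_dPlus hf.contDiffAt h

theorem contDiff_dMinus {f : ℂ → E} {m n : ℕ} (hf : ContDiff ℝ n f) (h : m + 1 ≤ n) :
    ContDiff ℝ m (dMinus f) :=
  contDiff_iff_contDiffAt.2 fun _ => contDiffAt_dMinus hf.contDiffAt h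

theorem d1_eq (f : ℂ → E) (ξ : ℂ) : d1 f ξ = dPlus f ξ + dMinus f ξ := by
  simp only [dPlus, dMinus]; module

theorem d2_eq (f : ℂ → E) (ξ : ℂ) : d2 f ξ = Complex.I • (dPlus f ξ - dMinus f ξ) := by
  have : Complex.I • (dPlus f ξ - dMinus f ξ) = (-(Complex.I * Complex.I)) • d2 f ξ := by
    simp only [dPlus, dMinus]; module
  rw [this]; simp

/-- The Wirtinger derivatives commute on functions of class `C²`. -/
theorem dPlus_dMinus_comm {f : ℂ → E} {ξ : ℂ} (hf : ContDiffAt ℝ 2 f ξ) :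
    dPlus (dMinus f) ξ = dMinus (dPlus f) ξ := by
  have hs : IsSymmSndFDerivAt ℝ f ξ := hf.isSymmSndFDerivAt (by simp)
  have h1 : DifferentiableAt ℝ (fderiv ℝ f) ξ :=
    (hf.fderiv_right (m := 1) (by norm_num)).differentiableAt (by norm_num)
  have h2 (v : ℂ) : DifferentiableAt ℝ (fun η => fderiv ℝ f η v) ξ :=
    h1.clm_apply (differentiableAt_const v)
  have h3 (v w : ℂ) : fderiv ℝ (fun η => fderiv ℝ f η v) ξ w = fderiv ℝ (fderiv ℝ f) ξ w v := by
    rw [fderiv_clm_apply h1 (differentiableAt_const v)]; simp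
  have h4 : DifferentiableAt ℝ (fun η => Complex.I • fderiv ℝ f η Complex.I) ξ :=
    (h2 Complex.I).const_smul Complex.I
  have hp (v : ℂ) : dPlus (fun η => fderiv ℝ f η v) ξ = (1 / 2 : ℂ) •
      (fderiv ℝ (fderiv ℝ f) ξ 1 v - Complex.I • fderiv ℝ (fderiv ℝ f) ξ Complex.I v) := by
    rw [dPlus_eq_fderiv, h3, h3]
  have hm (v : ℂ) : dMinus (fun η => fderiv ℝ f η v) ξ = (1 / 2 : ℂ) •
      (fderiv ℝ (fderiv ℝ f) ξ 1 v + Complex.I • fderiv ℝ (fderiv ℝ f) ξ Complex.I v) := by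
    rw [dMinus_eq_fderiv, h3, h3]
  have e1 : dPlus (dMinus f) ξ = (1 / 2 : ℂ) • (dPlus (fun η => fderiv ℝ f η 1) ξ +
      Complex.I • dPlus (fun η => fderiv ℝ f η Complex.I) ξ) := by
    rw [← dPlus_const_smul Complex.I (h2 Complex.I),
      ← dPlus_add (h2 1) h4, ← dPlus_const_smul _ ((h2 1).fun_add h4)]
    rfl
  have e2 : dMinus (dPlus f) ξ = (1 / 2 : ℂ) • (dMinus (fun η => fderiv ℝ f η 1) ξ -
      Complex.I • dMinus (fun η => fderiv ℝ f η Complex.I) ξ) := by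
    rw [← dMinus_const_smul Complex.I (h2 Complex.I),
      ← dMinus_sub (h2 1) h4, ← dMinus_const_smul _ ((h2 1).fun_sub h4)]
    rfl
  rw [e1, e2, hp, hp, hm, hm, hs.eq 1 Complex.I]
  module

/-- A real differentiable function killed by `∂₋` is complex differentiable. -/
theorem differentiableAt_of_dMinus_eq_zero {f : ℂ → ℂ} {ξ : ℂ} (hf : DifferentiableAt ℝ f ξ)
    (h : dMinus f ξ = 0) : DifferentiableAt ℂ f ξ := by
  rw [differentiableAt_complex_iff_differentiableAt_real]
  refine ⟨hf, ?_⟩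
  rw [dMinus_eq_fderiv, smul_eq_zero] at h
  have h' := h.resolve_left (by norm_num)
  have : fderiv ℝ f ξ 1 = -(Complex.I • fderiv ℝ f ξ Complex.I) := eq_neg_of_add_eq_zero_left h'
  rw [this, smul_neg, smul_smul, Complex.I_mul_I]; simp

end Calculus

/-! ### Derivatives of adjoints, traces and transposes. -/

section MatrixCalculus

variable {N : ℕ}

theorem differentiableAt_conjTranspose_iff {f : ℂ → Mat N} {ξ : ℂ} :
    DifferentiableAt ℝ (fun η => (f η).conjTranspose) ξ ↔ DifferentiableAt ℝ f ξ :=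
  (starL' ℝ : Mat N ≃L[ℝ] Mat N).comp_differentiableAt_iff

/-- The adjoint is a real linear equivalence, so the default values on both sides agree and no
differentiability is needed. Being conjugate linear, it exchanges `∂₊` and `∂₋`; transposition,
which is complex linear, does not. -/
theorem fderiv_conjTranspose (f : ℂ → Mat N) (ξ v : ℂ) :
    fderiv ℝ (fun η => (f η).conjTranspose) ξ v = (fderiv ℝ f ξ v).conjTranspose := by
  have := (starL' ℝ : Mat N ≃L[ℝ] Mat N).comp_fderiv (f := f) (x := ξ)
  exact congrArg (fun T => T v) this

theorem dPlus_conjTranspose (f : ℂ → Mat N) (ξ : ℂ) :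
    dPlus (fun η => (f η).conjTranspose) ξ = (dMinus f ξ).conjTranspose := by
  simp [dPlus_eq_fderiv, dMinus_eq_fderiv, fderiv_conjTranspose, sub_eq_add_neg,
    Matrix.conjTranspose_smul]

theorem dMinus_conjTranspose (f : ℂ → Mat N) (ξ : ℂ) :
    dMinus (fun η => (f η).conjTranspose) ξ = (dPlus f ξ).conjTranspose := by
  simp [dPlus_eq_fderiv, dMinus_eq_fderiv, fderiv_conjTranspose, sub_eq_add_neg,
    Matrix.conjTranspose_smul]

/-- The trace as a continuous linear map. -/
def traceCLM (N : ℕ) : Mat N →L[ℂ] ℂ :=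
  LinearMap.toContinuousLinearMap (Matrix.traceLinearMap _ ℂ ℂ)

theorem dPlus_trace {f : ℂ → Mat N} {ξ : ℂ} (hf : DifferentiableAt ℝ f ξ) :
    dPlus (fun η => (f η).trace) ξ = (dPlus f ξ).trace :=
  dPlus_clm_comp (traceCLM N) hf

theorem dMinus_trace {f : ℂ → Mat N} {ξ : ℂ} (hf : DifferentiableAt ℝ f ξ) :
    dMinus (fun η => (f η).trace) ξ = (dMinus f ξ).trace :=
  dMinus_clm_comp (traceCLM N) hf

theorem contDiffAt_trace {f : ℂ → Mat N} {ξ : ℂ} {n : ℕ} (hf : ContDiffAt ℝ n f ξ) :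
    ContDiffAt ℝ n (fun η => (f η).trace) ξ :=
  ((traceCLM N).restrictScalars ℝ).contDiff.contDiffAt.comp ξ hf

/-- Transposition as a continuous linear equivalence. -/
def transposeCLE (N : ℕ) : Mat N ≃L[ℂ] Mat N :=
  (Matrix.transposeLinearEquiv (Fin N) (Fin N) ℂ ℂ).toContinuousLinearEquiv

theorem transposeCLE_apply (A : Mat N) : transposeCLE N A = A.transpose := rfl

theorem fderiv_transpose (f : ℂ → Mat N) (ξ v : ℂ) :
    fderiv ℝ (fun η => (f η).transpose) ξ v = (fderiv ℝ f ξ v).transpose := by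
  have := ((transposeCLE N).restrictScalars ℝ).comp_fderiv (f := f) (x := ξ)
  exact congrArg (fun T => T v) this

theorem dPlus_transpose (f : ℂ → Mat N) (ξ : ℂ) :
    dPlus (fun η => (f η).transpose) ξ = (dPlus f ξ).transpose := by
  simp [dPlus_eq_fderiv, fderiv_transpose]

theorem dMinus_transpose (f : ℂ → Mat N) (ξ : ℂ) :
    dMinus (fun η => (f η).transpose) ξ = (dMinus f ξ).transpose := by
  simp [dMinus_eq_fderiv, fderiv_transpose]

theorem contDiff_transpose {f : ℂ → Mat N} {n : ℕ} (hf : ContDiff ℝ n f) :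
    ContDiff ℝ n (fun η => (f η).transpose) :=
  ((transposeCLE N).restrictScalars ℝ).contDiff.comp hf

end MatrixCalculus

/-! ### Algebra of projectors and of their derivatives. -/

section RankOne

variable {N : ℕ}

/-- A rank-one projector compresses every matrix to a multiple of itself. -/
theorem IsRankOneProjector.mul_mul {x : Mat N} (hx : IsRankOneProjector x) (A : Mat N) :
    x * A * x = (x * A).trace • x := by
  obtain ⟨h1, -, h3⟩ := hx
  set T := Matrix.toLin' x with hT
  have hi : IsIdempotentElem T := by
    rw [IsIdempotentElem, hT, Module.End.mul_eq_comp, ← Matrix.toLin'_mul, h1]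
  -- The rank of an idempotent is its trace, so the range is a line, on which `x * A` acts by a
  -- scalar.
  have hr : Module.finrank ℂ (LinearMap.range T) = 1 := by
    have := (LinearMap.IsIdempotentElem.isProj_range T hi).trace
    rw [hT, Matrix.trace_toLin'_eq, h3] at this
    exact_mod_cast this.symm
  obtain ⟨v, -, hv⟩ := finrank_eq_one_iff'.1 hr
  have key : ∃ c : ℂ, x * A * x = c • x := by
    obtain ⟨c, hc⟩ := hv ⟨T (A.mulVec v), LinearMap.mem_range_self _ _⟩
    have hc' : c • (v : Fin N → ℂ) = x.mulVec (A.mulVec v) := by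
      simpa [hT] using congrArg Subtype.val hc
    refine ⟨c, Matrix.toLin'.injective (LinearMap.ext fun w => ?_)⟩
    obtain ⟨d, hd⟩ := hv ⟨T w, LinearMap.mem_range_self _ _⟩
    have hd' : d • (v : Fin N → ℂ) = x.mulVec w := by
      simpa [hT] using congrArg Subtype.val hd
    simp only [Matrix.toLin'_apply, ← Matrix.mulVec_mulVec, Matrix.smul_mulVec, ← hd',
      Matrix.mulVec_smul, ← hc']
    rw [smul_comm]
  obtain ⟨c, hc⟩ := key
  have ht : (x * A * x).trace = (x * A).trace := by
    rw [Matrix.trace_mul_comm, ← mul_assoc, h1]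
  rw [hc, Matrix.trace_smul, h3, smul_eq_mul, mul_one] at ht
  rw [hc, ht]

end RankOne

section Idempotent

variable {R : Type*} [Ring R]

/-- The hypothesis is the derivative of `x² = x`; it makes `u` off-diagonal with respect to `x`. -/
theorem mul_mul_eq_zero_of_leibniz {x u : R} (hx : x * x = x) (hu : u * x + x * u = u) :
    x * u * x = 0 := by
  have h : x * u * x = x * u * x + x * u * x := by
    conv_lhs => rw [← hu]
    simp only [mul_add, add_mul, mul_assoc, hx]
    simp only [← mul_assoc, hx]
  simpa using h

/-- Moving past one off-diagonal factor turns `x` into `1 - x`; moving past two restores it. -/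
theorem mul_mul_comm_of_leibniz {x u v : R} (hu : u * x + x * u = u) (hv : v * x + x * v = v) :
    u * v * x = x * (u * v) := by
  have h1 : x * u = u - u * x := eq_sub_of_add_eq' hu
  have h2 : x * v = v - v * x := eq_sub_of_add_eq' hv
  rw [← mul_assoc, h1, sub_mul, mul_assoc u x v, h2, mul_sub, mul_assoc]; abel

end Idempotent

section Field

variable {N : ℕ} {X Y : ℂ → Mat N} {ξ : ℂ}

theorem dPlus_leibniz (hX : ∀ᶠ η in 𝓝 ξ, IsRankOneProjector (X η)) (hd : DifferentiableAt ℝ X ξ) :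
    dPlus X ξ * X ξ + X ξ * dPlus X ξ = dPlus X ξ := by
  rw [← dPlus_mul hd hd]
  exact dPlus_congr (hX.mono fun η h => h.1)

theorem dMinus_leibniz (hX : ∀ᶠ η in 𝓝 ξ, IsRankOneProjector (X η)) (hd : DifferentiableAt ℝ X ξ) :
    dMinus X ξ * X ξ + X ξ * dMinus X ξ = dMinus X ξ := by
  rw [← dMinus_mul hd hd]
  exact dMinus_congr (hX.mono fun η h => h.1)

theorem conjTranspose_dPlus (hX : ∀ᶠ η in 𝓝 ξ, (X η).conjTranspose = X η) :
    (dPlus X ξ).conjTranspose = dMinus X ξ := by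
  rw [← dMinus_conjTranspose]
  exact dMinus_congr hX

theorem conjTranspose_dMinus (hX : ∀ᶠ η in 𝓝 ξ, (X η).conjTranspose = X η) :
    (dMinus X ξ).conjTranspose = dPlus X ξ := by
  rw [← dPlus_conjTranspose]
  exact dPlus_congr hX

end Field

/-! ### The extended quotient `M / tr M`. -/

section TraceQuotient

variable {N : ℕ} {M : ℂ → Mat N}

/-- A closed condition that holds for `0` and for `M / tr M` off the zeros of `M` holds for the
extended quotient. -/
theorem traceQuotient_of_isClosed {p : ℂ → Mat N → Prop}
    (hp : IsClosed {q : ℂ × Mat N | p q.1 q.2}) (h0 : ∀ ξ, p ξ 0)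
    (h : ∀ ξ, M ξ ≠ 0 → p ξ ((M ξ).trace⁻¹ • M ξ)) (ξ : ℂ) : p ξ (traceQuotient M ξ) := by
  unfold traceQuotient
  split_ifs with h1 h2
  · exact h ξ h1
  · obtain ⟨hc, l, hl⟩ := h2
    rw [extendFrom_eq hc hl]
    have : (𝓝[{η | M η ≠ 0}] ξ).NeBot := mem_closure_iff_nhdsWithin_neBot.1 hc
    have ht : Filter.Tendsto (fun η => (η, (M η).trace⁻¹ • M η)) (𝓝[{η | M η ≠ 0}] ξ)
        (𝓝 (ξ, l)) := (Filter.tendsto_id'.2 nhdsWithin_le_nhds).prodMk_nhds hl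
    exact hp.mem_of_tendsto ht (eventually_nhdsWithin_of_forall fun η hη => h η hη)
  · exact h0 ξ

theorem traceQuotient_mul_eq_zero {B : ℂ → Mat N} (hB : Continuous B)
    (h : ∀ ξ, M ξ * B ξ = 0) (ξ : ℂ) : traceQuotient M ξ * B ξ = 0 := by
  refine traceQuotient_of_isClosed (p := fun ξ A => A * B ξ = 0) ?_ (by simp) ?_ ξ
  · exact isClosed_eq (continuous_snd.mul (hB.comp continuous_fst)) continuous_const
  · intro ξ _
    rw [smul_mul_assoc, h, smul_zero]

theorem traceQuotient_conjTranspose (h : ∀ ξ, (M ξ).conjTranspose = M ξ) (ξ : ℂ) :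
    (traceQuotient M ξ).conjTranspose = traceQuotient M ξ := by
  refine traceQuotient_of_isClosed (p := fun _ A => A.conjTranspose = A) ?_ (by simp) ?_ ξ
  · exact isClosed_eq (continuous_snd.matrix_conjTranspose) continuous_snd
  · intro ξ _
    rw [Matrix.conjTranspose_smul, h, star_inv₀, ← Matrix.trace_conjTranspose, h]

theorem traceQuotient_of_ne_zero {ξ : ℂ} (h : M ξ ≠ 0) :
    traceQuotient M ξ = (M ξ).trace⁻¹ • M ξ := if_pos h

/-- Such a zero is not a limit of non-zeros, so the last branch of the definition applies. -/
theorem traceQuotient_eq_zero {U : Set ℂ} (hU : IsOpen U) (h : ∀ ξ ∈ U, M ξ = 0) {ξ : ℂ}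
    (hξ : ξ ∈ U) : traceQuotient M ξ = 0 := by
  have h1 : ¬ M ξ ≠ 0 := not_not.2 (h ξ hξ)
  have h2 : ξ ∉ closure {η | M η ≠ 0} := fun hc => by
    obtain ⟨η, hη, hη'⟩ := mem_closure_iff.1 hc U hU hξ
    exact hη' (h η hη)
  unfold traceQuotient
  rw [if_neg h1, if_neg fun hc => h2 hc.1]

theorem transpose_traceQuotient (M : ℂ → Mat N) (ξ : ℂ) :
    (traceQuotient M ξ).transpose = traceQuotient (fun η => (M η).transpose) ξ := by
  have hs : {η | (M η).transpose ≠ 0} = {η | M η ≠ 0} := by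
    ext η; simp
  have hf : (fun η => (M η).transpose.trace⁻¹ • (M η).transpose) =
      fun η => transposeCLE N ((M η).trace⁻¹ • M η) := by
    ext1 η; rw [map_smul, transposeCLE_apply, Matrix.trace_transpose]
  unfold traceQuotient
  rw [hs, hf]
  by_cases h1 : M ξ ≠ 0
  · rw [if_pos h1, if_pos (by simpa using h1), Matrix.transpose_smul, Matrix.trace_transpose]
  have h1' : ¬ (M ξ).transpose ≠ 0 := by simpa using h1
  rw [if_neg h1, if_neg h1']
  by_cases h2 : ξ ∈ closure {η | M η ≠ 0} ∧
      ∃ l, Filter.Tendsto (fun η => (M η).trace⁻¹ • M η) (𝓝[{η | M η ≠ 0}] ξ) (𝓝 l)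
  · obtain ⟨hc, l, hl⟩ := h2
    have hl' := ((transposeCLE N).continuous.tendsto l).comp hl
    rw [if_pos ⟨hc, l, hl⟩, if_pos ⟨hc, _, hl'⟩, extendFrom_eq hc hl]
    exact (extendFrom_eq hc hl').symm
  · rw [if_neg h2, if_neg, Matrix.transpose_zero]
    rintro ⟨hc, l, hl⟩
    refine h2 ⟨hc, (transposeCLE N).symm l, ?_⟩
    simpa [Function.comp_def] using ((transposeCLE N).symm.continuous.tendsto l).comp hl

end TraceQuotient

/-! ### Raising and lowering without regularity assumptions. -/

section Raising

variable {N : ℕ} {X : ℂ → Mat N}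

theorem raising_conjTranspose (h : ∀ ξ, (X ξ).conjTranspose = X ξ) (ξ : ℂ) :
    (raising X ξ).conjTranspose = raising X ξ := by
  refine traceQuotient_conjTranspose (fun η => ?_) ξ
  rw [Matrix.conjTranspose_mul, Matrix.conjTranspose_mul, h,
    conjTranspose_dPlus (Filter.Eventually.of_forall h),
    conjTranspose_dMinus (Filter.Eventually.of_forall h), mul_assoc]

theorem iterate_raising_conjTranspose (h : ∀ ξ, (X ξ).conjTranspose = X ξ) (j : ℕ) :
    ∀ ξ, (raising^[j] X ξ).conjTranspose = raising^[j] X ξ := by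
  induction j with
  | zero => exact h
  | succ j ih =>
    rw [Function.iterate_succ_apply']
    exact raising_conjTranspose ih

/-- If `X B = 0` and `X ∂₋B = 0` then `(Π₊X) B = 0`; no regularity of `X` is needed. -/
theorem raising_mul_eq_zero {B : ℂ → Mat N} (hB : Differentiable ℝ B) (h0 : ∀ ξ, X ξ * B ξ = 0)
    (h1 : ∀ ξ, X ξ * dMinus B ξ = 0) (ξ : ℂ) : raising X ξ * B ξ = 0 := by
  refine traceQuotient_mul_eq_zero hB.continuous (fun η => ?_) ξ
  -- Differentiating `X B = 0` gives `∂₋X B = 0`; where `X` is not differentiable, `∂₋X` is zero by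
  -- convention.
  by_cases hd : DifferentiableAt ℝ X η
  · have h := dMinus_mul hd (hB η)
    rw [h1, add_zero, show (fun ζ => X ζ * B ζ) = fun _ => 0 from funext h0, dMinus_const] at h
    rw [mul_assoc, ← h, mul_zero]
  · rw [dMinus_eq_zero_of_not_differentiableAt hd, mul_zero, zero_mul]

/-- Transposition reverses the order of the factors and keeps `∂₊` and `∂₋`, so facts about raising
transfer to lowering. -/
theorem transpose_lowering (X : ℂ → Mat N) :
    (fun ξ => (lowering X ξ).transpose) = raising fun ξ => (X ξ).transpose := by
  ext1 ξ
  unfold lowering raising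
  rw [transpose_traceQuotient]
  simp only [Matrix.transpose_mul, dPlus_transpose, dMinus_transpose, mul_assoc]

theorem transpose_iterate_lowering (X : ℂ → Mat N) (k : ℕ) :
    (fun ξ => (lowering^[k] X ξ).transpose) = raising^[k] fun ξ => (X ξ).transpose := by
  induction k with
  | zero => rfl
  | succ k ih =>
    rw [Function.iterate_succ_apply', Function.iterate_succ_apply', ← ih, ← transpose_lowering]

theorem raising_eq_zero_of_isOpen {U : Set ℂ} (hU : IsOpen U) (h : ∀ ξ ∈ U, X ξ = 0) {ξ : ℂ}
    (hξ : ξ ∈ U) : raising X ξ = 0 :=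
  traceQuotient_eq_zero hU (fun η hη => by rw [h η hη, mul_zero, zero_mul]) hξ

@[simp] theorem raising_zero : raising (0 : ℂ → Mat N) = 0 :=
  funext fun _ => raising_eq_zero_of_isOpen isOpen_univ (fun _ _ => rfl) (Set.mem_univ _)

end Raising

/-! ### Covariant jets of a projector field. -/

section Jets

variable {N : ℕ}

/-- The covariant derivative `∇₋B = (∂₋B) P` of a homomorphism from the image of `P`. -/
def covMinus (P B : ℂ → Mat N) (ξ : ℂ) : Mat N := dMinus B ξ * P ξ

/-- The iterated covariant derivative `∇₋ᵐ P`. -/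
def jet (P : ℂ → Mat N) (m : ℕ) : ℂ → Mat N := (covMinus P)^[m] P

variable {P : ℂ → Mat N}

@[simp] theorem jet_zero (P : ℂ → Mat N) : jet P 0 = P := rfl

theorem jet_succ (P : ℂ → Mat N) (m : ℕ) (ξ : ℂ) :
    jet P (m + 1) ξ = dMinus (jet P m) ξ * P ξ := by
  rw [jet, Function.iterate_succ_apply']; rfl

theorem contDiff_jet {n : ℕ} (hP : ContDiff ℝ n P) {m : ℕ} :
    ∀ {k : ℕ}, m + k ≤ n → ContDiff ℝ k (jet P m) := by
  induction m with
  | zero => intro k hk; exact hP.of_le (by exact_mod_cast (by omega : k ≤ n))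
  | succ m ih =>
    intro k hk
    have h : jet P (m + 1) = fun ξ => dMinus (jet P m) ξ * P ξ := funext (jet_succ P m)
    rw [h]
    exact (contDiff_dMinus (ih (k := k + 1) (by omega)) le_rfl).mul
      (hP.of_le (by exact_mod_cast (by omega : k ≤ n)))

theorem jet_mul (hP : ∀ ξ, P ξ * P ξ = P ξ) (m : ℕ) (ξ : ℂ) : jet P m ξ * P ξ = jet P m ξ := by
  cases m with
  | zero => exact hP ξ
  | succ m => rw [jet_succ, mul_assoc, hP]

/-- If `X` annihilates the jet of order `m + 1` and the jet of order `m` then it annihilates the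
derivative of the latter. -/
theorem mul_dMinus_jet (hP : ∀ ξ, P ξ * P ξ = P ξ) (hd : Differentiable ℝ P) {m : ℕ}
    (hj : Differentiable ℝ (jet P m)) {A : Mat N} {ξ : ℂ} (h0 : A * jet P m ξ = 0)
    (h1 : A * jet P (m + 1) ξ = 0) : A * dMinus (jet P m) ξ = 0 := by
  -- With `B = B P` for the jet `B`, the Leibniz rule reads `∂₋B = ∇₋B + B ∂₋P`.
  have h := dMinus_mul (hj ξ) (hd ξ)
  rw [show (fun η => jet P m η * P η) = jet P m from funext (jet_mul hP m), ← jet_succ] at h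
  rw [h, mul_add, h1, ← mul_assoc, h0, zero_mul, add_zero]

namespace IsFiniteActionSolution

variable (hP : IsFiniteActionSolution P)
include hP

theorem mul_self (ξ : ℂ) : P ξ * P ξ = P ξ := (hP.isProjector ξ).1

theorem conjTranspose (ξ : ℂ) : (P ξ).conjTranspose = P ξ := (hP.isProjector ξ).2.1

theorem contDiff_of_le {k : ℕ} (hk : k ≤ N + 2) : ContDiff ℝ k P :=
  hP.contDiff.of_le (by exact_mod_cast hk)

theorem differentiable : Differentiable ℝ P :=
  (hP.contDiff_of_le (k := 1) (by omega)).differentiable (by norm_num)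

theorem conjTranspose_dPlus (ξ : ℂ) : (dPlus P ξ).conjTranspose = dMinus P ξ :=
  CPModel.conjTranspose_dPlus (Filter.Eventually.of_forall hP.conjTranspose)

theorem conjTranspose_dMinus (ξ : ℂ) : (dMinus P ξ).conjTranspose = dPlus P ξ :=
  CPModel.conjTranspose_dMinus (Filter.Eventually.of_forall hP.conjTranspose)

theorem dPlus_leibniz (ξ : ℂ) : dPlus P ξ * P ξ + P ξ * dPlus P ξ = dPlus P ξ :=
  CPModel.dPlus_leibniz (Filter.Eventually.of_forall hP.isProjector) (hP.differentiable ξ)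

theorem dMinus_leibniz (ξ : ℂ) : dMinus P ξ * P ξ + P ξ * dMinus P ξ = dMinus P ξ :=
  CPModel.dMinus_leibniz (Filter.Eventually.of_forall hP.isProjector) (hP.differentiable ξ)

theorem dPlus_dMinus_mul (ξ : ℂ) : dPlus (dMinus P) ξ * P ξ = P ξ * dPlus (dMinus P) ξ :=
  sub_eq_zero.1 (hP.euler_lagrange ξ)

theorem dPlus_dMinus_comm (ξ : ℂ) : dPlus (dMinus P) ξ = dMinus (dPlus P) ξ :=
  CPModel.dPlus_dMinus_comm (hP.contDiff_of_le (k := 2) (by omega)).contDiffAt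

theorem differentiable_jet {m : ℕ} (hm : m ≤ N + 1) : Differentiable ℝ (jet P m) :=
  (contDiff_jet (k := 1) hP.contDiff (by omega)).differentiable (by norm_num)

end IsFiniteActionSolution

end Jets

/-! ### Higher isotropy of harmonic spheres. -/

section Isotropy

variable {N : ℕ} {P : ℂ → Mat N}

namespace IsFiniteActionSolution

variable (hP : IsFiniteActionSolution P)
include hP

/-- The curvature of the line bundle of images of `P`. -/
theorem exists_curvature : ∃ κ : ℂ → ℂ, ContDiff ℝ (N + 1 : ℕ) κ ∧ ∀ ξ,
    P ξ * (dMinus P ξ * dPlus P ξ - dPlus P ξ * dMinus P ξ) * P ξ = κ ξ • P ξ := by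
  refine ⟨_, ?_, fun ξ => (hP.isProjector ξ).mul_mul _⟩
  have hp := contDiff_dPlus hP.contDiff (m := N + 1) le_rfl
  have hm := contDiff_dMinus hP.contDiff (m := N + 1) le_rfl
  have h := (hP.contDiff_of_le (k := N + 1) (by omega)).mul ((hm.mul hp).sub (hp.mul hm))
  exact contDiff_iff_contDiffAt.2 fun ξ => contDiffAt_trace h.contDiffAt

/-- Flat derivatives commute, so the commutator of `∇₊` and `∇₋` comes only from the projection onto
the image of `P`, and is multiplication by the curvature `κ`. -/
theorem dPlus_jet_succ_mul {κ : ℂ → ℂ} (hκ : ∀ ξ,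
    P ξ * (dMinus P ξ * dPlus P ξ - dPlus P ξ * dMinus P ξ) * P ξ = κ ξ • P ξ)
    {m : ℕ} (hm : m ≤ N) (ξ : ℂ) :
    dPlus (jet P (m + 1)) ξ * P ξ =
      dMinus (fun η => dPlus (jet P m) η * P η) ξ * P ξ + κ ξ • jet P m ξ := by
  have hB : ContDiff ℝ (2 : ℕ) (jet P m) := contDiff_jet hP.contDiff (by omega)
  have hd := hP.differentiable
  have hBd : Differentiable ℝ (jet P m) := hP.differentiable_jet (by omega)
  have hBp : Differentiable ℝ (dPlus (jet P m)) :=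
    (contDiff_dPlus hB (m := 1) le_rfl).differentiable (by norm_num)
  have hBm : Differentiable ℝ (dMinus (jet P m)) :=
    (contDiff_dMinus hB (m := 1) le_rfl).differentiable (by norm_num)
  have hjs : jet P (m + 1) = fun η => dMinus (jet P m) η * P η := funext (jet_succ P m)
  have hl := dMinus_mul (hBd ξ) (hd ξ)
  have hr := dPlus_mul (hBd ξ) (hd ξ)
  rw [show (fun η => jet P m η * P η) = jet P m from funext (jet_mul hP.mul_self m)] at hl hr
  rw [hjs, dPlus_mul (hBm ξ) (hd ξ), dMinus_mul (hBp ξ) (hd ξ),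
    CPModel.dPlus_dMinus_comm hB.contDiffAt]
  have hu := mul_mul_eq_zero_of_leibniz (hP.mul_self ξ) (hP.dPlus_leibniz ξ)
  have hv := mul_mul_eq_zero_of_leibniz (hP.mul_self ξ) (hP.dMinus_leibniz ξ)
  have k1 : dMinus (jet P m) ξ * dPlus P ξ * P ξ =
      jet P m ξ * dMinus P ξ * dPlus P ξ * P ξ := by
    conv_lhs => rw [hl]
    simp only [add_mul, mul_assoc] at hu ⊢
    rw [hu, mul_zero, zero_add]
  have k2 : dPlus (jet P m) ξ * dMinus P ξ * P ξ =
      jet P m ξ * dPlus P ξ * dMinus P ξ * P ξ := by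
    conv_lhs => rw [hr]
    simp only [add_mul, mul_assoc] at hv ⊢
    rw [hv, mul_zero, zero_add]
  have k3 : κ ξ • jet P m ξ = jet P m ξ * dMinus P ξ * dPlus P ξ * P ξ -
      jet P m ξ * dPlus P ξ * dMinus P ξ * P ξ := by
    rw [← jet_mul hP.mul_self m ξ, ← mul_smul_comm, ← hκ]
    simp only [← mul_assoc, jet_mul hP.mul_self, mul_sub, sub_mul]
  rw [k3, add_mul, add_mul, k1, k2]
  abel

/-- `∇₊∇₋ᵐ⁺¹P` is a regular combination of the jets of order at most `m`. -/
theorem exists_coeff {m : ℕ} (hm : m ≤ N) : ∃ c : ℕ → ℂ → ℂ,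
    (∀ i, ContDiff ℝ (N - m : ℕ) (c i)) ∧
    ∀ ξ, dPlus (jet P (m + 1)) ξ * P ξ = ∑ i ∈ Finset.range (m + 1), c i ξ • jet P i ξ := by
  obtain ⟨κ, hκ, hκP⟩ := hP.exists_curvature
  induction m with
  | zero =>
    have hp := contDiff_dPlus hP.contDiff (m := N) (by omega)
    have hmi := contDiff_dMinus hP.contDiff (m := N) (by omega)
    have hpm := contDiff_dPlus (contDiff_dMinus hP.contDiff (m := N + 1) le_rfl) (m := N) le_rfl
    have hd := hP.differentiable
    have hpd : Differentiable ℝ (dPlus P) :=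
      (contDiff_dPlus (hP.contDiff_of_le (k := 2) (by omega)) (m := 1) le_rfl).differentiable
        (by norm_num)
    -- Harmonicity enters here: `∂₊∂₋P + ∂₊P ∂₋P` commutes with `P`, so `∇₋∇₊P` has the form `P A
    -- P`, a multiple of `P`; the curvature adds `κ P`.
    refine ⟨fun _ ξ => (P ξ * (dPlus (dMinus P) ξ + dPlus P ξ * dMinus P ξ)).trace + κ ξ,
      fun _ => ?_, fun ξ => ?_⟩
    · refine ContDiff.add ?_ (hκ.of_le (by exact_mod_cast (by omega : N - 0 ≤ N + 1)))
      exact contDiff_iff_contDiffAt.2 fun ξ => contDiffAt_trace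
        ((hP.contDiff_of_le (k := N) (by omega)).mul (hpm.add (hp.mul hmi))).contDiffAt
    · rw [hP.dPlus_jet_succ_mul hκP hm, Finset.sum_range_one, jet_zero, add_smul,
        ← (hP.isProjector ξ).mul_mul, dMinus_mul (hpd ξ) (hd ξ), ← hP.dPlus_dMinus_comm,
        mul_add, ← hP.dPlus_dMinus_mul,
        ← mul_mul_comm_of_leibniz (hP.dPlus_leibniz ξ) (hP.dMinus_leibniz ξ)]
      simp only [add_mul, mul_assoc, hP.mul_self]
  | succ m ih =>
    obtain ⟨c, hc, h⟩ := ih (by omega)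
    -- Applying `∇₋` to `c i • jet P i` gives `∂₋(c i)` at index `i` and `c i` at index `i + 1`; the
    -- curvature contributes `κ` at the new top index `m + 1`.
    refine ⟨fun i => (if i < m + 1 then dMinus (c i) else κ) + if i = 0 then 0 else c (i - 1),
      fun i => ?_, fun ξ => ?_⟩
    · refine ContDiff.add ?_ ?_
      · split_ifs
        · exact contDiff_dMinus (hc i) (by omega)
        · exact hκ.of_le (by exact_mod_cast (by omega : N - (m + 1) ≤ N + 1))
      · split_ifs
        · exact contDiff_const
        · exact (hc _).of_le (by exact_mod_cast (by omega : N - (m + 1) ≤ N - m))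
    have hcd : ∀ i, Differentiable ℝ (c i) := fun i =>
      (hc i).differentiable (by exact_mod_cast (by omega : N - m ≠ 0))
    have hj : ∀ i ∈ Finset.range (m + 1), Differentiable ℝ (jet P i) := fun i hi =>
      hP.differentiable_jet (by have := Finset.mem_range.1 hi; omega)
    have e1 : dMinus (fun η => dPlus (jet P (m + 1)) η * P η) ξ * P ξ =
        ∑ i ∈ Finset.range (m + 1), (c i ξ • jet P (i + 1) ξ + dMinus (c i) ξ • jet P i ξ) := by
      rw [show (fun η => dPlus (jet P (m + 1)) η * P η) = _ from funext h,
        dMinus_sum (Finset.range (m + 1)) (f := fun i η => c i η • jet P i η)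
          fun i hi => (hcd i ξ).smul (hj i hi ξ), Finset.sum_mul]
      refine Finset.sum_congr rfl fun i hi => ?_
      rw [dMinus_smul (hcd i ξ) (hj i hi ξ), add_mul, smul_mul_assoc, smul_mul_assoc,
        ← jet_succ, jet_mul hP.mul_self]
    have s1 : ∑ i ∈ Finset.range (m + 1), (if i < m + 1 then dMinus (c i) else κ) ξ • jet P i ξ =
        ∑ i ∈ Finset.range (m + 1), dMinus (c i) ξ • jet P i ξ :=
      Finset.sum_congr rfl fun i hi => by rw [if_pos (Finset.mem_range.1 hi)]
    have s2 : ∑ i ∈ Finset.range (m + 1 + 1), (if i = 0 then 0 else c (i - 1)) ξ • jet P i ξ =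
        ∑ i ∈ Finset.range (m + 1), c i ξ • jet P (i + 1) ξ := by
      rw [Finset.sum_range_succ']
      simp
    simp only [Pi.add_apply, add_smul, Finset.sum_add_distrib]
    rw [hP.dPlus_jet_succ_mul hκP hm, e1, s2,
      Finset.sum_range_succ (fun i => (if i < m + 1 then dMinus (c i) else κ) ξ • jet P i ξ), s1,
      if_neg (lt_irrefl _),
      Finset.sum_add_distrib]
    abel

end IsFiniteActionSolution

theorem fderiv_comp_inv {E : Type*} [NormedAddCommGroup E] [NormedSpace ℂ E] {C : ℂ → E} {ξ : ℂ}
    (hξ : ξ ≠ 0) (hC : DifferentiableAt ℝ C ξ⁻¹) (v : ℂ) :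
    fderiv ℝ (fun η => C η⁻¹) ξ v = (-((ξ⁻¹) ^ 2) * v) • dPlus C ξ⁻¹ +
      (starRingEnd ℂ (-((ξ⁻¹) ^ 2) * v)) • dMinus C ξ⁻¹ := by
  have h1 : HasFDerivAt (fun η : ℂ => η⁻¹) _ ξ := (hasDerivAt_inv hξ).complexToReal_fderiv
  have h2 : fderiv ℝ (fun η => C η⁻¹) ξ = _ := (hC.hasFDerivAt.comp ξ h1).fderiv
  have h3 (z : ℂ) : fderiv ℝ C ξ⁻¹ z = z • dPlus C ξ⁻¹ + (starRingEnd ℂ z) • dMinus C ξ⁻¹ := by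
    have e : fderiv ℝ C ξ⁻¹ z = (z.re : ℂ) • d1 C ξ⁻¹ + (z.im : ℂ) • d2 C ξ⁻¹ := by
      conv_lhs => rw [← Complex.re_add_im z, map_add]
      have h4 : ((z.re : ℂ)) = z.re • (1 : ℂ) := by simp
      have h5 : ((z.im : ℂ)) * Complex.I = z.im • Complex.I := by simp
      rw [h5, h4, map_smul, map_smul]
      simp only [d1, d2, Complex.real_smul, mul_one, Complex.coe_smul]
    have hz : z = z.re + z.im * Complex.I := (Complex.re_add_im z).symm
    have hz' : starRingEnd ℂ z = z.re - z.im * Complex.I := by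
      apply Complex.ext <;> simp
    have hs : z • dPlus C ξ⁻¹ = ((z.re : ℂ) + z.im * Complex.I) • dPlus C ξ⁻¹ := by rw [← hz]
    rw [e, hz', hs, d1_eq, d2_eq]
    module
  rw [h2, ContinuousLinearMap.comp_apply, h3]
  simp [inv_pow]

/-- Inversion is holomorphic, so it rescales `∂₋` without mixing in `∂₊`. -/
theorem dMinus_comp_inv {E : Type*} [NormedAddCommGroup E] [NormedSpace ℂ E] {C : ℂ → E} {ξ : ℂ}
    (hξ : ξ ≠ 0) (hC : DifferentiableAt ℝ C ξ⁻¹) :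
    dMinus (fun η => C η⁻¹) ξ = (-(starRingEnd ℂ ξ⁻¹) ^ 2) • dMinus C ξ⁻¹ := by
  have hI : Complex.I * Complex.I = -1 := Complex.I_mul_I
  rw [dMinus_eq_fderiv, fderiv_comp_inv hξ hC, fderiv_comp_inv hξ hC]
  simp only [map_mul, map_neg, map_pow, Complex.conj_I, map_one]
  match_scalars
  · linear_combination (-(ξ⁻¹ ^ 2) / 2) * hI
  · linear_combination ((starRingEnd ℂ ξ⁻¹) ^ 2 / 2) * hI

theorem dPlus_comp_inv {E : Type*} [NormedAddCommGroup E] [NormedSpace ℂ E] {C : ℂ → E} {ξ : ℂ}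
    (hξ : ξ ≠ 0) (hC : DifferentiableAt ℝ C ξ⁻¹) :
    dPlus (fun η => C η⁻¹) ξ = (-(ξ⁻¹) ^ 2) • dPlus C ξ⁻¹ := by
  have hI : Complex.I * Complex.I = -1 := Complex.I_mul_I
  rw [dPlus_eq_fderiv, fderiv_comp_inv hξ hC, fderiv_comp_inv hξ hC]
  simp only [map_mul, map_neg, map_pow, Complex.conj_I, map_one]
  match_scalars
  · linear_combination (ξ⁻¹ ^ 2 / 2) * hI
  · linear_combination (-(starRingEnd ℂ ξ⁻¹) ^ 2 / 2) * hI

/-- The jets of a field that is regular at infinity, in the coordinate `1 / ξ`. -/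
def jetInv (R : ℂ → Mat N) : ℕ → ℂ → Mat N
  | 0 => R
  | m + 1 => fun w => (-(starRingEnd ℂ w) ^ 2) • (dMinus (jetInv R m) w * R w)

theorem contDiff_jetInv {R : ℂ → Mat N} {n : ℕ} (hR : ContDiff ℝ n R) {m : ℕ} :
    ∀ {k : ℕ}, m + k ≤ n → ContDiff ℝ k (jetInv R m) := by
  induction m with
  | zero => intro k hk; exact hR.of_le (by exact_mod_cast (by omega : k ≤ n))
  | succ m ih =>
    intro k hk
    exact ((Complex.conjCLE.contDiff.pow 2).neg).smul
      ((contDiff_dMinus (ih (k := k + 1) (by omega)) le_rfl).mul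
        (hR.of_le (by exact_mod_cast (by omega : k ≤ n))))

theorem jet_eq_jetInv {R : ℂ → Mat N} {n : ℕ} (hR : ContDiff ℝ n R)
    (h : ∀ w, w ≠ 0 → R w = P w⁻¹) {m : ℕ} (hm : m ≤ n) :
    ∀ ξ, ξ ≠ 0 → jet P m ξ = jetInv R m ξ⁻¹ := by
  induction m with
  | zero => intro ξ hξ; rw [jet_zero, jetInv, h _ (inv_ne_zero hξ), inv_inv]
  | succ m ih =>
    intro ξ hξ
    have hd : DifferentiableAt ℝ (jetInv R m) ξ⁻¹ :=
      ((contDiff_jetInv hR (k := 1) (by omega)).differentiable (by norm_num)) _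
    change _ = (-(starRingEnd ℂ ξ⁻¹) ^ 2) • (dMinus (jetInv R m) ξ⁻¹ * R ξ⁻¹)
    rw [jet_succ, ← smul_mul_assoc, ← dMinus_comp_inv hξ hd, h _ (inv_ne_zero hξ), inv_inv]
    congr 1
    refine dMinus_congr ?_
    filter_upwards [isOpen_ne.mem_nhds hξ] with η hη using ih (by omega) η hη

namespace IsFiniteActionSolution

variable (hP : IsFiniteActionSolution P)
include hP

/-- In the coordinate `w = 1 / ξ` the operator `∂₊` becomes `-w² ∂_w`, whose factor vanishes at `w =
0`; the other factors stay continuous there. -/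
theorem tendsto_trace_jet {m : ℕ} (hm : m ≤ N + 1) :
    Filter.Tendsto (fun ξ => ((jet P m ξ).conjTranspose * (dPlus P ξ * P ξ)).trace)
      (Filter.cocompact ℂ) (𝓝 0) := by
  obtain ⟨R, hR, h⟩ := hP.contDiff_at_infty
  have hc : Continuous fun w => ((jetInv R m w).conjTranspose *
      (((-w ^ 2) • dPlus R w) * R w)).trace := by
    have h1 : Continuous (jetInv R m) := (contDiff_jetInv hR (k := 0) (by omega)).continuous
    have h2 : Continuous (dPlus R) := (contDiff_dPlus hR (m := 0) (by omega)).continuous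
    exact (h1.matrix_conjTranspose.mul ((((continuous_id.pow 2).neg).smul h2).mul
      hR.continuous)).matrix_trace
  have h0 := hc.tendsto 0
  simp only [ne_eq, OfNat.ofNat_ne_zero, not_false_eq_true, zero_pow, neg_zero, zero_smul,
    zero_mul, mul_zero, Matrix.trace_zero] at h0
  rw [← Metric.cobounded_eq_cocompact]
  refine (h0.comp Filter.tendsto_inv₀_cobounded).congr' ?_
  have hne : ∀ᶠ ξ : ℂ in Bornology.cobounded ℂ, ξ ≠ 0 := by
    rw [Metric.cobounded_eq_cocompact]
    exact (isCompact_singleton (x := (0 : ℂ))).compl_mem_cocompact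
  filter_upwards [hne] with ξ hξ
  have hd : DifferentiableAt ℝ R ξ⁻¹ :=
    (hR.differentiable (by exact_mod_cast (by omega : N + 2 ≠ 0))) _
  have e : dPlus P ξ = (-(ξ⁻¹) ^ 2) • dPlus R ξ⁻¹ := by
    rw [← dPlus_comp_inv hξ hd]
    refine dPlus_congr ?_
    filter_upwards [isOpen_ne.mem_nhds hξ] with η hη
    rw [h _ (inv_ne_zero hη), inv_inv]
  rw [Function.comp_apply, jet_eq_jetInv hR h (by omega) ξ hξ, e, h _ (inv_ne_zero hξ), inv_inv]

/-- The two claims support each other in the induction: vanishing of `P * jet P m` and isotropy at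
order `m` give the former at order `m + 1`, which is then needed for holomorphy of the next pairing.
-/
theorem isotropy_aux {m : ℕ} (hm : m ≤ N + 1) :
    (∀ i ≤ m, ∀ ξ, (jet P i ξ).conjTranspose * (dPlus P ξ * P ξ) = 0) ∧
      (1 ≤ m → ∀ ξ, P ξ * jet P m ξ = 0) := by
  induction m with
  | zero =>
    refine ⟨fun i hi ξ => ?_, fun h => absurd h (by norm_num)⟩
    rw [Nat.le_zero.1 hi, jet_zero, hP.conjTranspose, ← mul_assoc]
    exact mul_mul_eq_zero_of_leibniz (hP.mul_self ξ) (hP.dPlus_leibniz ξ)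
  | succ m ih =>
    obtain ⟨ih1, ih2⟩ := ih (by omega)
    have h0 : ∀ ξ, P ξ * jet P (m + 1) ξ = 0 := by
      intro ξ
      have hv := mul_mul_eq_zero_of_leibniz (hP.mul_self ξ) (hP.dMinus_leibniz ξ)
      rcases Nat.eq_zero_or_pos m with rfl | hm0
      · rw [jet_succ, jet_zero, ← mul_assoc, hv]
      · have hb := ih2 hm0
        have h := dMinus_mul (hP.differentiable ξ) (hP.differentiable_jet (m := m) (by omega) ξ)
        rw [show (fun η => P η * jet P m η) = fun _ => 0 from funext hb, dMinus_const] at h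
        have h1 := congrArg Matrix.conjTranspose (ih1 m le_rfl ξ)
        simp only [Matrix.conjTranspose_mul, Matrix.conjTranspose_conjTranspose,
          hP.conjTranspose, hP.conjTranspose_dPlus, Matrix.conjTranspose_zero] at h1
        have h2 : dMinus P ξ * jet P m ξ = 0 := by
          rw [← hP.dMinus_leibniz, add_mul, mul_assoc, hb, mul_zero, zero_add, h1]
        rw [h2, zero_add] at h
        rw [jet_succ, ← mul_assoc, ← h, zero_mul]
    refine ⟨fun i hi => ?_, fun _ => h0⟩
    rcases Nat.lt_or_ge m i with hi' | hi'
    swap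
    · exact ih1 i hi'
    obtain rfl : i = m + 1 := le_antisymm hi hi'
    have hPA : ∀ ξ, (jet P (m + 1) ξ).conjTranspose * P ξ = 0 := fun ξ => by
      simpa [hP.conjTranspose] using congrArg Matrix.conjTranspose (h0 ξ)
    have hPl : ∀ ξ, P ξ * (jet P (m + 1) ξ).conjTranspose = (jet P (m + 1) ξ).conjTranspose :=
      fun ξ => by
        simpa [hP.conjTranspose] using congrArg Matrix.conjTranspose (jet_mul hP.mul_self (m + 1) ξ)
    have hB : Differentiable ℝ (jet P (m + 1)) := hP.differentiable_jet hm
    have hB' : Differentiable ℝ fun ξ => (jet P (m + 1) ξ).conjTranspose :=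
      fun ξ => differentiableAt_conjTranspose_iff.2 (hB ξ)
    have hd := hP.differentiable
    have hdp : Differentiable ℝ (dPlus P) :=
      (contDiff_dPlus (hP.contDiff_of_le (k := 2) (by omega)) (m := 1) le_rfl).differentiable
        (by norm_num)
    set g : ℂ → ℂ := fun ξ => ((jet P (m + 1) ξ).conjTranspose * (dPlus P ξ * P ξ)).trace with hg
    have hF : Differentiable ℝ fun ξ => (jet P (m + 1) ξ).conjTranspose * (dPlus P ξ * P ξ) :=
      hB'.mul (hdp.mul hd)
    have hgd : Differentiable ℝ g := ((traceCLM N).restrictScalars ℝ).differentiable.comp hF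
    -- In `∂₋g` the derivative of the jet is a combination of lower jets, orthogonal by induction
    -- (`t1`); harmonicity removes the mixed second derivative, and `∂₊P ∂₋P` commutes with `P`
    -- (`t2`).
    have hg0 : ∀ ξ, dMinus g ξ = 0 := by
      intro ξ
      obtain ⟨c, -, hc⟩ := hP.exists_coeff (m := m) (by omega)
      rw [hg, dMinus_trace (hF ξ), dMinus_mul (hB' ξ) ((hdp ξ).fun_mul (hd ξ)),
        dMinus_mul (hdp ξ) (hd ξ), dMinus_conjTranspose, ← hP.dPlus_dMinus_comm,
        hP.dPlus_dMinus_mul, mul_add, ← mul_assoc _ (P ξ), hPA, zero_mul, zero_add,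
        Matrix.trace_add]
      have t1 : ((dPlus (jet P (m + 1)) ξ).conjTranspose * (dPlus P ξ * P ξ)).trace = 0 := by
        have := congrArg Matrix.conjTranspose (hc ξ)
        rw [Matrix.conjTranspose_mul, hP.conjTranspose] at this
        rw [← hP.mul_self ξ, ← mul_assoc, ← mul_assoc, Matrix.trace_mul_comm, ← mul_assoc,
          ← mul_assoc, this, Matrix.conjTranspose_sum, mul_assoc, Finset.sum_mul,
          Finset.sum_eq_zero, Matrix.trace_zero]
        intro i hi
        rw [Matrix.conjTranspose_smul, smul_mul_assoc,
          ih1 i (Nat.lt_succ_iff.1 (Finset.mem_range.1 hi)), smul_zero]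
      have t2 : ((jet P (m + 1) ξ).conjTranspose * (dPlus P ξ * dMinus P ξ)).trace = 0 := by
        rw [← hPl, mul_assoc, Matrix.trace_mul_comm, mul_assoc,
          mul_mul_comm_of_leibniz (hP.dPlus_leibniz ξ) (hP.dMinus_leibniz ξ), ← mul_assoc, hPA,
          zero_mul, Matrix.trace_zero]
      rw [t1, t2, add_zero]
    -- Liouville: `g` is entire with limit zero at infinity.
    have hgz : ∀ ξ, g ξ = 0 := fun ξ =>
      Differentiable.apply_eq_of_tendsto_cocompact
        (fun η => differentiableAt_of_dMinus_eq_zero (hgd η) (hg0 η)) ξ (hP.tendsto_trace_jet hm)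
    intro ξ
    -- The matrix has the form `P A P`, so it vanishes with its trace.
    have hr := (hP.isProjector ξ).mul_mul ((jet P (m + 1) ξ).conjTranspose * dPlus P ξ)
    rw [← mul_assoc, hPl, mul_assoc] at hr
    have hz : ((jet P (m + 1) ξ).conjTranspose * dPlus P ξ).trace = 0 := by
      rw [← hPl, mul_assoc, Matrix.trace_mul_comm, mul_assoc]
      exact hgz ξ
    rw [hr, hz, zero_smul]

/-- The higher isotropy of harmonic spheres: `∂₊P P` is orthogonal to all the jets `∇₋ᵐP`. -/
theorem isotropy {m : ℕ} (hm : m ≤ N + 1) (ξ : ℂ) :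
    P ξ * dMinus P ξ * jet P m ξ = 0 := by
  have h1 := congrArg Matrix.conjTranspose ((hP.isotropy_aux hm).1 m le_rfl ξ)
  simpa [Matrix.conjTranspose_mul, hP.conjTranspose, hP.conjTranspose_dPlus] using h1

end IsFiniteActionSolution

end Isotropy

/-! ### Orthogonality of raised projectors to jets. -/

section Orthogonality

variable {N : ℕ} {P : ℂ → Mat N}

/-- The raised projectors are orthogonal to the jets of `P`. -/
theorem IsFiniteActionSolution.iterate_raising_mul_jet (hP : IsFiniteActionSolution P) {j : ℕ} :
    ∀ {m : ℕ}, j + m ≤ N + 1 → ∀ ξ, raising^[j + 1] P ξ * jet P m ξ = 0 := by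
  induction j with
  | zero =>
    intro m hm ξ
    change raising P ξ * jet P m ξ = 0
    unfold raising
    refine traceQuotient_mul_eq_zero (hP.differentiable_jet (m := m) (by omega)).continuous
      (fun η => ?_) ξ
    rw [mul_assoc, mul_assoc, ← mul_assoc (P η), hP.isotropy (by omega), mul_zero]
  | succ j ih =>
    intro m hm ξ
    rw [Function.iterate_succ_apply']
    have hd := hP.differentiable_jet (m := m) (by omega)
    -- Orders `m` and `m + 1` before raising yield order `m` after it.
    exact raising_mul_eq_zero hd (ih (by omega)) (fun η => mul_dMinus_jet hP.mul_self
      hP.differentiable hd (ih (by omega) η) (ih (by omega) η)) ξ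

theorem IsFiniteActionSolution.iterate_raising_conjTranspose (hP : IsFiniteActionSolution P)
    (j : ℕ) (ξ : ℂ) : (raising^[j] P ξ).conjTranspose = raising^[j] P ξ :=
  CPModel.iterate_raising_conjTranspose hP.conjTranspose j ξ

theorem mul_eq_zero_comm_of_hermitian {A B : Mat N} (hA : A.conjTranspose = A)
    (hB : B.conjTranspose = B) (h : A * B = 0) : B * A = 0 := by
  simpa [hA, hB] using congrArg Matrix.conjTranspose h

end Orthogonality

/-! ### Pointwise algebra of one raising step. -/

section FrenetAlgebra

variable {N : ℕ}

open scoped ComplexOrder in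
-- The trace is the squared norm of `u * x`, so the denominator vanishes only with the numerator.
theorem trace_ne_zero_of_rankOne {x u : Mat N} (hx : IsRankOneProjector x)
    (h : u * x * u.conjTranspose ≠ 0) : (u * x * u.conjTranspose).trace ≠ 0 := by
  intro ht
  have e : u * x * u.conjTranspose = u * x * (u * x).conjTranspose := by
    rw [Matrix.conjTranspose_mul, hx.2.1, ← mul_assoc, mul_assoc u x x, hx.1]
  rw [e, Matrix.trace_mul_conjTranspose_self_eq_zero_iff] at ht
  exact h (by rw [ht, zero_mul])

theorem mul_conjTranspose_mul_mul {x : Mat N} (hx : IsRankOneProjector x) (u : Mat N) :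
    u * x * u.conjTranspose * (u * x) = (u * x * u.conjTranspose).trace • (u * x) := by
  have h := hx.mul_mul (u.conjTranspose * u)
  rw [show (x * (u.conjTranspose * u)).trace = (u * x * u.conjTranspose).trace by
    rw [← mul_assoc, Matrix.trace_mul_comm, mul_assoc]] at h
  rw [← mul_smul_comm, ← h]
  simp only [mul_assoc]

theorem isRankOneProjector_quotient {x u : Mat N} (hx : IsRankOneProjector x)
    (h : u * x * u.conjTranspose ≠ 0) :
    IsRankOneProjector ((u * x * u.conjTranspose).trace⁻¹ • (u * x * u.conjTranspose)) := by
  have ht := trace_ne_zero_of_rankOne hx h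
  have hM : (u * x * u.conjTranspose).conjTranspose = u * x * u.conjTranspose := by
    simp [Matrix.conjTranspose_mul, hx.2.1, mul_assoc]
  refine ⟨?_, ?_, ?_⟩
  · rw [smul_mul_smul_comm, ← mul_assoc (u * x * _), mul_conjTranspose_mul_mul hx, smul_mul_assoc,
      smul_smul, mul_assoc, inv_mul_cancel₀ ht, mul_one]
  · rw [Matrix.conjTranspose_smul, hM, star_inv₀, ← Matrix.trace_conjTranspose, hM]
  · rw [Matrix.trace_smul, smul_eq_mul, inv_mul_cancel₀ ht]

/-- Here `xp`, `xm`, `ym` stand for `∂₊x`, `∂₋x`, `∂₋y`, and `w` for `∂₊∂₋x`. Hypothesis `h` is `∂₋`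
of `y ∂₊x x = ∂₊x x`; multiplied by `x` on the right it puts `∂₋y ∂₊x x` in the range of `x`, and
`y` is built from `∂₊x x`. -/
theorem mul_eq_of_frenet_down {x y xp xm ym w : Mat N} {c : ℂ} (hx : x * x = x) (hyx : y * x = 0)
    (hw : w * x = x * w) (hc : xp * xm * x = x * (xp * xm)) (hy : y = c • (xp * x * xm))
    (h : ym * (xp * x) + y * (w * x + xp * xm) = w * x + xp * xm) :
    ym * y = x * ym * y := by
  have h1 : ym * (xp * x) = x * (w + xp * xm) := by
    have h2 := congrArg (· * x) h
    simp only [add_mul, mul_add] at h2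
    rw [show ym * (xp * x) * x = ym * (xp * x) by simp only [mul_assoc, hx],
      show w * x * x = x * w by rw [mul_assoc, hx, hw], hc,
      show y * (w * x) * x = 0 by rw [hw, ← mul_assoc, hyx, zero_mul, zero_mul],
      show y * (xp * xm) * x = 0 by rw [mul_assoc, hc, ← mul_assoc, hyx, zero_mul],
      add_zero, add_zero, ← mul_add] at h2
    exact h2
  have h3 : ym * y = c • (x * (w + xp * xm) * xm) := by
    rw [hy, mul_smul_comm, ← mul_assoc, h1]
  rw [mul_assoc, h3, mul_smul_comm, ← mul_assoc, ← mul_assoc, hx]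

/-- Here `z` stands for `∂₊∂₋y`. The second derivative `h2` of `x y = 0` yields `x z y = 0`; then
`h1`, the `∂₊` derivative of the downward Frenet equation, expresses `z y` through terms in the
range of `y`. -/
theorem mul_eq_of_frenet_harmonic {x y xp xm yp ym w z : Mat N} (hx : x * x = x)
    (hxy : x * y = 0) (hw : w * x = x * w)
    (hup : y * (xp * x) = xp * x) (hup' : x * xm = x * xm * y) (hdown : ym * y = x * ym * y)
    (hxp : x * xp * x = 0) (hyp : y * yp * y = 0) (hc : ym * yp * y = y * (ym * yp))
    (h1 : z * y + ym * yp = xp * (ym * y) + x * (z * y + ym * yp)) (hy : y * y = y)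
    (h2 : w * y + xm * yp + (xp * ym + x * z) = 0) : z * y = y * (z * y) := by
  have e1 : x * z * y = 0 := by
    have h3 := congrArg (fun A => x * A * y) h2
    simp only [mul_add, add_mul, mul_zero, zero_mul] at h3
    have t1 : x * (w * y) * y = 0 := by
      rw [← mul_assoc, ← hw, mul_assoc w, hxy, mul_zero, zero_mul]
    have t2 : x * (xm * yp) * y = 0 := by
      rw [← mul_assoc, hup', mul_assoc, mul_assoc, ← mul_assoc y, hyp, mul_zero]
    have t3 : x * (xp * ym) * y = 0 := by
      rw [mul_assoc, mul_assoc, hdown, ← mul_assoc, ← mul_assoc, ← mul_assoc, hxp, zero_mul,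
        zero_mul]
    rw [t1, t2, t3, ← mul_assoc x x, hx] at h3
    simpa using h3
  have h4 := congrArg (· * y) h1
  simp only [add_mul, mul_add] at h4
  have t4 : x * (ym * yp) * y = 0 := by rw [mul_assoc, hc, ← mul_assoc, hxy, zero_mul]
  have t5 : xp * (ym * y) * y = y * (xp * x * (ym * y)) := by
    rw [← mul_assoc y, hup, mul_assoc, mul_assoc ym, hy, mul_assoc xp, ← mul_assoc x, ← hdown]
  rw [t4, t5, hc, mul_assoc z, hy, ← mul_assoc x z, mul_assoc (x * z), hy, e1, add_zero,
    add_zero] at h4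
  have h5 : z * y = y * (xp * x * (ym * y) - ym * yp) := by
    rw [mul_sub]; exact eq_sub_of_add_eq h4
  rw [h5, ← mul_assoc y y, hy]

end FrenetAlgebra

/-! ### Frenet equations on open sets. -/

section Frenet

variable {N : ℕ}

/-- On the open set `U` the fields `P, Π₊P, …, Π₊ᵏP` are regular, mutually orthogonal harmonic
projectors that satisfy the Frenet equations. -/
structure FrenetOn (P : ℂ → Mat N) (k : ℕ) (U : Set ℂ) : Prop where
  isOpen : IsOpen U
  contDiffAt : ∀ j ≤ k, ∀ ξ ∈ U, ContDiffAt ℝ (N + 2 - j : ℕ) (raising^[j] P) ξ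
  isProjector : ∀ j ≤ k, ∀ ξ ∈ U, IsRankOneProjector (raising^[j] P ξ)
  harmonic : ∀ j ≤ k, ∀ ξ ∈ U, dPlus (dMinus (raising^[j] P)) ξ * raising^[j] P ξ =
    raising^[j] P ξ * dPlus (dMinus (raising^[j] P)) ξ
  orth : ∀ i j, i < j → j ≤ k → ∀ ξ ∈ U, raising^[j] P ξ * raising^[i] P ξ = 0
  up : ∀ j < k, ∀ ξ ∈ U, raising^[j + 1] P ξ * (dPlus (raising^[j] P) ξ * raising^[j] P ξ) =
    dPlus (raising^[j] P) ξ * raising^[j] P ξ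
  down : ∀ j < k, ∀ ξ ∈ U, dMinus (raising^[j + 1] P) ξ * raising^[j + 1] P ξ =
    raising^[j] P ξ * dMinus (raising^[j + 1] P) ξ * raising^[j + 1] P ξ

variable {P : ℂ → Mat N} {k : ℕ} {U : Set ℂ}

theorem FrenetOn.mono (h : FrenetOn P k U) {V : Set ℂ} (hV : IsOpen V) (hVU : V ⊆ U) :
    FrenetOn P k V where
  isOpen := hV
  contDiffAt j hj ξ hξ := h.contDiffAt j hj ξ (hVU hξ)
  isProjector j hj ξ hξ := h.isProjector j hj ξ (hVU hξ)
  harmonic j hj ξ hξ := h.harmonic j hj ξ (hVU hξ)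
  orth i j hi hj ξ hξ := h.orth i j hi hj ξ (hVU hξ)
  up j hj ξ hξ := h.up j hj ξ (hVU hξ)
  down j hj ξ hξ := h.down j hj ξ (hVU hξ)

theorem IsFiniteActionSolution.frenetOn_zero (hP : IsFiniteActionSolution P) (hU : IsOpen U) :
    FrenetOn P 0 U where
  isOpen := hU
  contDiffAt j hj ξ _ := by
    rw [Nat.le_zero.1 hj]; exact hP.contDiff.contDiffAt
  isProjector j hj ξ _ := by rw [Nat.le_zero.1 hj]; exact hP.isProjector ξ
  harmonic j hj ξ _ := by rw [Nat.le_zero.1 hj]; exact hP.dPlus_dMinus_mul ξ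
  orth i j hi hj := by omega
  up j hj := by omega
  down j hj := by omega

/-- The algebra and calculus of a single raising step on an open set. -/
theorem frenet_step {x y : ℂ → Mat N} (hU : IsOpen U) (hx : ∀ ξ ∈ U, IsRankOneProjector (x ξ))
    (hy : ∀ ξ ∈ U, IsRankOneProjector (y ξ)) (hx2 : ∀ ξ ∈ U, ContDiffAt ℝ (2 : ℕ) x ξ)
    (hy2 : ∀ ξ ∈ U, ContDiffAt ℝ (2 : ℕ) y ξ)
    (hyq : ∀ ξ ∈ U, ∃ c : ℂ, y ξ = c • (dPlus x ξ * x ξ * dMinus x ξ))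
    (hyx : ∀ ξ ∈ U, y ξ * x ξ = 0)
    (hup : ∀ ξ ∈ U, y ξ * (dPlus x ξ * x ξ) = dPlus x ξ * x ξ)
    (hel : ∀ ξ ∈ U, dPlus (dMinus x) ξ * x ξ = x ξ * dPlus (dMinus x) ξ) :
    (∀ ξ ∈ U, dMinus y ξ * y ξ = x ξ * dMinus y ξ * y ξ) ∧
    ∀ ξ ∈ U, dPlus (dMinus y) ξ * y ξ = y ξ * dPlus (dMinus y) ξ := by
  have near {p : ℂ → Prop} (h : ∀ ξ ∈ U, p ξ) {ξ : ℂ} (hξ : ξ ∈ U) : ∀ᶠ η in 𝓝 ξ, p η := by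
    filter_upwards [hU.mem_nhds hξ] with η hη using h η hη
  have dx : ∀ ξ ∈ U, DifferentiableAt ℝ x ξ := fun ξ hξ => (hx2 ξ hξ).differentiableAt (by norm_num)
  have dy : ∀ ξ ∈ U, DifferentiableAt ℝ y ξ := fun ξ hξ => (hy2 ξ hξ).differentiableAt (by norm_num)
  have dxp : ∀ ξ ∈ U, DifferentiableAt ℝ (dPlus x) ξ := fun ξ hξ =>
    (contDiffAt_dPlus (m := 1) (hx2 ξ hξ) le_rfl).differentiableAt (by norm_num)
  have dxm : ∀ ξ ∈ U, DifferentiableAt ℝ (dMinus x) ξ := fun ξ hξ =>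
    (contDiffAt_dMinus (m := 1) (hx2 ξ hξ) le_rfl).differentiableAt (by norm_num)
  have dym : ∀ ξ ∈ U, DifferentiableAt ℝ (dMinus y) ξ := fun ξ hξ =>
    (contDiffAt_dMinus (m := 1) (hy2 ξ hξ) le_rfl).differentiableAt (by norm_num)
  have lxp := fun ξ hξ => dPlus_leibniz (near hx hξ) (dx ξ hξ)
  have lxm := fun ξ hξ => dMinus_leibniz (near hx hξ) (dx ξ hξ)
  have lyp := fun ξ hξ => dPlus_leibniz (near hy hξ) (dy ξ hξ)
  have lym := fun ξ hξ => dMinus_leibniz (near hy hξ) (dy ξ hξ)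
  have hxy : ∀ ξ ∈ U, x ξ * y ξ = 0 := fun ξ hξ =>
    mul_eq_zero_comm_of_hermitian (hy ξ hξ).2.1 (hx ξ hξ).2.1 (hyx ξ hξ)
  have down : ∀ ξ ∈ U, dMinus y ξ * y ξ = x ξ * dMinus y ξ * y ξ := by
    intro ξ hξ
    obtain ⟨c, hc⟩ := hyq ξ hξ
    refine mul_eq_of_frenet_down (hx ξ hξ).1 (hyx ξ hξ) (hel ξ hξ)
      (mul_mul_comm_of_leibniz (lxp ξ hξ) (lxm ξ hξ)) hc ?_
    have h := dMinus_congr (near hup hξ)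
    rw [dMinus_mul (dy ξ hξ) ((dxp ξ hξ).fun_mul (dx ξ hξ)), dMinus_mul (dxp ξ hξ) (dx ξ hξ),
      ← dPlus_dMinus_comm (hx2 ξ hξ)] at h
    exact h
  refine ⟨down, fun ξ hξ => ?_⟩
  have hx' := near (fun ξ hξ => (hx ξ hξ).2.1) hξ
  have hy' := fun {ξ : ℂ} (hξ : ξ ∈ U) => near (fun ξ hξ => (hy ξ hξ).2.1) hξ
  have key : dPlus (dMinus y) ξ * y ξ = y ξ * (dPlus (dMinus y) ξ * y ξ) := by
    refine mul_eq_of_frenet_harmonic (xm := dMinus x ξ) (hx ξ hξ).1 (hxy ξ hξ) (hel ξ hξ)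
      (hup ξ hξ) ?_ (down ξ hξ) (mul_mul_eq_zero_of_leibniz (hx ξ hξ).1 (lxp ξ hξ))
      (mul_mul_eq_zero_of_leibniz (hy ξ hξ).1 (lyp ξ hξ))
      (mul_mul_comm_of_leibniz (lym ξ hξ) (lyp ξ hξ)) ?_ (hy ξ hξ).1 ?_
    · have h := congrArg Matrix.conjTranspose (hup ξ hξ)
      rw [Matrix.conjTranspose_mul, Matrix.conjTranspose_mul, conjTranspose_dPlus hx',
        (hx ξ hξ).2.1, (hy ξ hξ).2.1] at h
      exact h.symm
    · have h := dPlus_congr (near (fun ξ hξ => (down ξ hξ).trans (mul_assoc _ _ _)) hξ)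
      rw [dPlus_mul (dx ξ hξ) ((dym ξ hξ).fun_mul (dy ξ hξ)), dPlus_mul (dym ξ hξ) (dy ξ hξ)] at h
      exact h
    · have h1 : ∀ ξ ∈ U, dMinus x ξ * y ξ + x ξ * dMinus y ξ = 0 := fun ξ hξ => by
        rw [← dMinus_mul (dx ξ hξ) (dy ξ hξ), dMinus_congr (near hxy hξ), dMinus_const]
      have h := dPlus_congr (near h1 hξ)
      rw [dPlus_const, dPlus_add ((dxm ξ hξ).fun_mul (dy ξ hξ)) ((dx ξ hξ).fun_mul (dym ξ hξ)),
        dPlus_mul (dxm ξ hξ) (dy ξ hξ), dPlus_mul (dx ξ hξ) (dym ξ hξ)] at h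
      exact h
  -- Since `∂₊∂₋y` is Hermitian, the adjoint of `z y = y z y` upgrades it to commutation.
  have herm : (dPlus (dMinus y) ξ).conjTranspose = dPlus (dMinus y) ξ := by
    rw [← dMinus_conjTranspose, dPlus_dMinus_comm (hy2 ξ hξ)]
    exact dMinus_congr (near (fun η hη => conjTranspose_dMinus (hy' hη)) hξ)
  have h := congrArg Matrix.conjTranspose key
  rw [Matrix.conjTranspose_mul, Matrix.conjTranspose_mul, Matrix.conjTranspose_mul, herm,
    (hy ξ hξ).2.1] at h
  rw [key, h, mul_assoc]

/-- Where the numerator does not vanish the quotient is a regular rank-one projector and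
`frenet_step` applies; what remains is its orthogonality to the earlier projectors. -/
theorem FrenetOn.succ (hP : IsFiniteActionSolution P) (h : FrenetOn P k U) (hk : k + 1 ≤ N)
    (hM : ∀ ξ ∈ U, dPlus (raising^[k] P) ξ * raising^[k] P ξ * dMinus (raising^[k] P) ξ ≠ 0) :
    FrenetOn P (k + 1) U := by
  set x := raising^[k] P with hx
  set y := raising^[k + 1] P with hy
  have hyr : y = raising x := Function.iterate_succ_apply' _ _ _
  have hxh := hP.iterate_raising_conjTranspose k
  have hxm : ∀ ξ, dMinus x ξ = (dPlus x ξ).conjTranspose := fun ξ =>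
    (conjTranspose_dPlus (Filter.Eventually.of_forall hxh)).symm
  have hxp := h.isProjector k le_rfl
  have hyq : ∀ ξ ∈ U, y ξ = (dPlus x ξ * x ξ * dMinus x ξ).trace⁻¹ •
      (dPlus x ξ * x ξ * dMinus x ξ) := fun ξ hξ => by
    rw [hyr]; exact traceQuotient_of_ne_zero (hM ξ hξ)
  have htr : ∀ ξ ∈ U, (dPlus x ξ * x ξ * dMinus x ξ).trace ≠ 0 := fun ξ hξ => by
    have := hM ξ hξ
    rw [hxm] at this ⊢
    exact trace_ne_zero_of_rankOne (hxp ξ hξ) this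
  have hyp : ∀ ξ ∈ U, IsRankOneProjector (y ξ) := fun ξ hξ => by
    have := hM ξ hξ
    rw [hyq ξ hξ]
    rw [hxm] at this ⊢
    exact isRankOneProjector_quotient (hxp ξ hξ) this
  have hxc := h.contDiffAt k le_rfl
  have hyc : ∀ ξ ∈ U, ContDiffAt ℝ (N + 2 - (k + 1) : ℕ) y ξ := fun ξ hξ => by
    have hMc : ContDiffAt ℝ (N + 2 - (k + 1) : ℕ) (fun η => dPlus x η * x η * dMinus x η) ξ :=
      ((contDiffAt_dPlus (hxc ξ hξ) (by omega)).mul ((hxc ξ hξ).of_le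
        (by exact_mod_cast (by omega : N + 2 - (k + 1) ≤ N + 2 - k)))).mul
        (contDiffAt_dMinus (hxc ξ hξ) (by omega))
    refine (((contDiffAt_trace hMc).inv (htr ξ hξ)).smul hMc).congr_of_eventuallyEq ?_
    filter_upwards [h.isOpen.mem_nhds hξ] with η hη using hyq η hη
  have hx2 : ∀ ξ ∈ U, ContDiffAt ℝ (2 : ℕ) x ξ := fun ξ hξ =>
    (hxc ξ hξ).of_le (by exact_mod_cast (by omega : 2 ≤ N + 2 - k))
  have hy2 : ∀ ξ ∈ U, ContDiffAt ℝ (2 : ℕ) y ξ := fun ξ hξ =>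
    -- The bound `k + 1 ≤ N` leaves the two derivatives that harmonicity requires.
    (hyc ξ hξ).of_le (by exact_mod_cast (by omega : 2 ≤ N + 2 - (k + 1)))
  have dx : ∀ ξ ∈ U, DifferentiableAt ℝ x ξ := fun ξ hξ => (hx2 ξ hξ).differentiableAt (by norm_num)
  have hyx : ∀ ξ ∈ U, y ξ * x ξ = 0 := fun ξ hξ => by
    have hl := dMinus_leibniz (ξ := ξ) (X := x)
      (by filter_upwards [h.isOpen.mem_nhds hξ] with η hη using hxp η hη) (dx ξ hξ)
    have h0 : dPlus x ξ * x ξ * dMinus x ξ * x ξ = 0 := by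
      rw [mul_assoc, mul_assoc, ← mul_assoc (x ξ), mul_mul_eq_zero_of_leibniz (hxp ξ hξ).1 hl,
        mul_zero]
    rw [hyq ξ hξ, smul_mul_assoc, h0, smul_zero]
  have hup : ∀ ξ ∈ U, y ξ * (dPlus x ξ * x ξ) = dPlus x ξ * x ξ := fun ξ hξ => by
    have := htr ξ hξ
    rw [hyq ξ hξ]
    rw [hxm] at this ⊢
    rw [smul_mul_assoc, mul_conjTranspose_mul_mul (hxp ξ hξ), smul_smul, inv_mul_cancel₀ this,
      one_smul]
  obtain ⟨hdown, hel⟩ := frenet_step h.isOpen hxp hyp hx2 hy2 (fun ξ hξ => ⟨_, hyq ξ hξ⟩) hyx hup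
    (h.harmonic k le_rfl)
  have horth : ∀ i < k + 1, ∀ ξ ∈ U, y ξ * raising^[i] P ξ = 0 := by
    intro i hi ξ hξ
    rcases Nat.lt_succ_iff_lt_or_eq.1 hi with hik | rfl
    swap
    · exact hyx ξ hξ
    set z := raising^[i] P with hz
    have dz : DifferentiableAt ℝ z ξ := (h.contDiffAt i hik.le ξ hξ).differentiableAt
      (by exact_mod_cast (by omega : N + 2 - i ≠ 0))
    have hzz := (h.isProjector i hik.le ξ hξ).1
    -- For positive `i` the downward equation puts `∂₋z z` in the range of the previous projector;
    -- for `i = 0` it is the first jet of `P`, handled by isotropy.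
    have h1 : x ξ * (dMinus z ξ * z ξ) = 0 := by
      cases i with
      | zero =>
        obtain ⟨l, rfl⟩ : ∃ l, k = l + 1 := ⟨k - 1, by omega⟩
        have := hP.iterate_raising_mul_jet (j := l) (m := 1) (by omega) ξ
        rwa [jet_succ] at this
      | succ i =>
        rw [h.down i (by omega) ξ hξ, mul_assoc, ← mul_assoc, h.orth i k (by omega) le_rfl ξ hξ,
          zero_mul]
    have h2 := dMinus_mul (dx ξ hξ) dz
    rw [dMinus_congr (g := fun _ => 0) (by
      filter_upwards [h.isOpen.mem_nhds hξ] with η hη using h.orth i k hik le_rfl η hη),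
      dMinus_const] at h2
    have h3 : dMinus x ξ * z ξ = 0 := by
      have h4 := congrArg (· * z ξ) h2
      simp only [zero_mul, add_mul] at h4
      rwa [mul_assoc, mul_assoc, h1, add_zero, hzz, eq_comm] at h4
    rw [hyq ξ hξ, smul_mul_assoc, mul_assoc (dPlus x ξ * x ξ), h3, mul_zero, smul_zero]
  have split {j : ℕ} (hj : j ≤ k + 1) : j ≤ k ∨ j = k + 1 := by omega
  have split' {j : ℕ} (hj : j < k + 1) : j < k ∨ j = k := by omega
  exact
  { isOpen := h.isOpen
    contDiffAt := fun j hj => (split hj).elim (h.contDiffAt j) (by rintro rfl; exact hyc)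
    isProjector := fun j hj => (split hj).elim (h.isProjector j) (by rintro rfl; exact hyp)
    harmonic := fun j hj => (split hj).elim (h.harmonic j) (by rintro rfl; exact hel)
    orth := fun i j hi hj => (split hj).elim (h.orth i j hi) (by rintro rfl; exact horth i hi)
    up := fun j hj => (split' hj).elim (h.up j) (by rintro rfl; exact hup)
    down := fun j hj => (split' hj).elim (h.down j) (by rintro rfl; exact hdown) }

/-- Shrink `U` at each step to where the numerator is nonzero. The hypothesis descends from `k + 1`
to `k` because raising a field that vanishes on an open set gives zero there. -/
theorem IsFiniteActionSolution.exists_frenetOn (hP : IsFiniteActionSolution P) (hk : k ≤ N)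
    (hU : IsOpen U) (hne : U.Nonempty)
    (hX : ∀ W ⊆ U, IsOpen W → W.Nonempty → ∃ ξ ∈ W, raising^[k] P ξ ≠ 0) :
    ∃ V ⊆ U, V.Nonempty ∧ FrenetOn P k V := by
  induction k with
  | zero => exact ⟨U, subset_rfl, hne, hP.frenetOn_zero hU⟩
  | succ k ih =>
    simp only [Function.iterate_succ_apply'] at hX
    obtain ⟨V, hVU, hV, hF⟩ := ih (by omega) fun W hWU hW hWn => by
      by_contra! hc
      obtain ⟨ξ, hξ, hξ'⟩ := hX W hWU hW hWn
      exact hξ' (raising_eq_zero_of_isOpen hW hc hξ)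
    set x := raising^[k] P with hx
    set M : ℂ → Mat N := fun ξ => dPlus x ξ * x ξ * dMinus x ξ with hM
    have hMc : ContinuousOn M V := fun ξ hξ => by
      have hc := hF.contDiffAt k le_rfl ξ hξ
      have h1 := contDiffAt_dPlus (m := 0) hc (by omega)
      have h2 := contDiffAt_dMinus (m := 0) hc (by omega)
      exact ((h1.continuousAt.mul hc.continuousAt).mul h2.continuousAt).continuousWithinAt
    refine ⟨V ∩ {ξ | M ξ ≠ 0}, Set.inter_subset_left.trans hVU, ?_, ?_⟩
    · by_contra hc
      obtain ⟨ξ, hξ, hξ'⟩ := hX V hVU hF.isOpen hV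
      exact hξ' (traceQuotient_eq_zero hF.isOpen
        (fun η hη => by_contra fun hη' => hc ⟨η, hη, hη'⟩) hξ)
    · have ho : IsOpen (V ∩ {ξ | M ξ ≠ 0}) :=
        hMc.isOpen_inter_preimage hF.isOpen isOpen_compl_singleton
      exact (hF.mono ho Set.inter_subset_left).succ hP hk fun ξ hξ => hξ.2

end Frenet

/-! ### Termination of the sequence and commutation with `P`. -/

section Vanishing

variable {N : ℕ} {P : ℂ → Mat N}

open scoped ComplexOrder in
/-- There are at most `N` mutually orthogonal rank-one projectors of size `N`. -/
theorem card_le_of_orthogonal {Y : ℕ → Mat N} {n : ℕ} (hY : ∀ i < n, IsRankOneProjector (Y i))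
    (ho : ∀ i < n, ∀ j < n, i ≠ j → Y i * Y j = 0) : n ≤ N := by
  set E : Mat N := ∑ i ∈ Finset.range n, Y i with hE
  have hEE : E * E = E := by
    rw [hE, Finset.sum_mul_sum]
    refine Finset.sum_congr rfl fun i hi => ?_
    rw [Finset.sum_eq_single_of_mem i hi fun j hj hij =>
      ho i (Finset.mem_range.1 hi) j (Finset.mem_range.1 hj) hij.symm]
    exact (hY i (Finset.mem_range.1 hi)).1
  have hEh : E.conjTranspose = E := by
    rw [hE, Matrix.conjTranspose_sum]
    exact Finset.sum_congr rfl fun i hi => (hY i (Finset.mem_range.1 hi)).2.1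
  have hEt : E.trace = n := by
    rw [hE, Matrix.trace_sum, Finset.sum_congr rfl fun i hi => (hY i (Finset.mem_range.1 hi)).2.2]
    simp
  -- The complement `1 - E` is a Hermitian idempotent of trace `N - n`, which must be nonnegative.
  have h := (Matrix.posSemidef_conjTranspose_mul_self (1 - E)).trace_nonneg
  rw [Matrix.conjTranspose_sub, hEh, Matrix.conjTranspose_one, sub_mul, mul_sub, mul_sub, hEE,
    mul_one, mul_one, one_mul, sub_self, sub_zero, Matrix.trace_sub, hEt, Matrix.trace_one,
    Fintype.card_fin, sub_nonneg] at h
  exact_mod_cast h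

theorem FrenetOn.lt {k : ℕ} {U : Set ℂ} (h : FrenetOn P k U) (hP : IsFiniteActionSolution P)
    (hU : U.Nonempty) : k < N := by
  obtain ⟨ξ, hξ⟩ := hU
  refine card_le_of_orthogonal (Y := fun j => raising^[j] P ξ)
    (fun i hi => h.isProjector i (by omega) ξ hξ) fun i hi j hj hij => ?_
  rcases lt_or_gt_of_ne hij with h1 | h1
  · exact mul_eq_zero_comm_of_hermitian (hP.iterate_raising_conjTranspose _ _)
      (hP.iterate_raising_conjTranspose _ _) (h.orth i j h1 (by omega) ξ hξ)
  · exact h.orth j i h1 (by omega) ξ hξ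

namespace IsFiniteActionSolution

variable (hP : IsFiniteActionSolution P)
include hP

/-- Counting projectors only forces the `N`-th iterate to vanish on a dense set; one more raising
removes its stray values. -/
theorem iterate_raising_eq_zero : raising^[N + 1] P = 0 := by
  have hdense : ∀ W : Set ℂ, IsOpen W → W.Nonempty → ∃ ξ ∈ W, raising^[N] P ξ = 0 := by
    intro W hW hne
    by_contra! hc
    obtain ⟨V, -, hV, hF⟩ := hP.exists_frenetOn le_rfl hW hne
      fun W' hW' _ ⟨ξ, hξ⟩ => ⟨ξ, hξ, hc ξ (hW' hξ)⟩
    exact absurd (hF.lt hP hV) (lt_irrefl _)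
  rw [Function.iterate_succ_apply']
  set x := raising^[N] P with hx
  funext ξ
  refine traceQuotient_eq_zero isOpen_univ (fun η _ => ?_) (Set.mem_univ ξ)
  -- Differentiability gives continuity, hence `x η = 0` by density; otherwise `∂₊x` is zero by
  -- convention.
  by_cases hd : DifferentiableAt ℝ x η
  · have hxη : x η = 0 := by
      by_contra hne
      have hn : ∀ᶠ ζ in 𝓝 η, x ζ ≠ 0 := hd.continuousAt.eventually_ne hne
      obtain ⟨W, hW, hWo, hηW⟩ := mem_nhds_iff.1 hn
      obtain ⟨ζ, hζ, h0⟩ := hdense W hWo ⟨η, hηW⟩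
      exact hW hζ h0
    rw [hxη, mul_zero, zero_mul]
  · rw [dPlus_eq_zero_of_not_differentiableAt hd, zero_mul, zero_mul]

theorem iterate_raising_eq_zero_of_lt {k : ℕ} (hk : N < k) : raising^[k] P = 0 := by
  obtain ⟨i, rfl⟩ : ∃ i, k = i + (N + 1) := ⟨k - (N + 1), by omega⟩
  rw [Function.iterate_add_apply, hP.iterate_raising_eq_zero]
  exact Function.iterate_fixed raising_zero i

/-- For positive `k` the product with `P` vanishes in both orders: by isotropy while jets are
available, and by termination beyond that. -/
theorem commute_iterate_raising (k : ℕ) (ξ : ℂ) : Commute (raising^[k] P ξ) (P ξ) := by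
  cases k with
  | zero => exact Commute.refl _
  | succ j =>
    have h : raising^[j + 1] P ξ * P ξ = 0 := by
      rcases Nat.lt_or_ge N (j + 1) with h1 | h1
      · rw [hP.iterate_raising_eq_zero_of_lt h1]; simp
      · exact hP.iterate_raising_mul_jet (m := 0) (by omega) ξ
    rw [Commute, SemiconjBy, h, mul_eq_zero_comm_of_hermitian
      (hP.iterate_raising_conjTranspose _ _) (hP.conjTranspose ξ) h]

theorem transpose : IsFiniteActionSolution fun ξ => (P ξ).transpose where
  isProjector ξ := by
    obtain ⟨h1, h2, h3⟩ := hP.isProjector ξ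
    refine ⟨?_, ?_, ?_⟩
    · rw [← Matrix.transpose_mul, h1]
    · exact congrArg Matrix.transpose h2
    · rw [Matrix.trace_transpose, h3]
  contDiff := contDiff_transpose hP.contDiff
  contDiff_at_infty := by
    obtain ⟨R, hR, h⟩ := hP.contDiff_at_infty
    exact ⟨_, contDiff_transpose hR, fun w hw => by rw [h w hw]⟩
  euler_lagrange ξ := by
    rw [show dMinus (fun ξ => (P ξ).transpose) = fun ξ => (dMinus P ξ).transpose from
      funext (dMinus_transpose P), dPlus_transpose, comm, ← Matrix.transpose_mul,
      ← Matrix.transpose_mul, hP.dPlus_dMinus_mul, sub_self]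
  finite_action := by
    have h : lagrangian (fun ξ => (P ξ).transpose) = lagrangian P := by
      funext ξ
      rw [lagrangian, lagrangian, dPlus_transpose, dMinus_transpose, ← Matrix.transpose_mul,
        Matrix.trace_transpose, Matrix.trace_mul_comm]
    rw [h]
    exact hP.finite_action

theorem commute_iterate_lowering (k : ℕ) (ξ : ℂ) : Commute (lowering^[k] P ξ) (P ξ) := by
  have h := hP.transpose.commute_iterate_raising k ξ
  rw [← transpose_iterate_lowering] at h
  have h' := congrArg Matrix.transpose h.eq
  simp only [Matrix.transpose_mul, Matrix.transpose_transpose] at h'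
  exact h'.symm

end IsFiniteActionSolution

/-- On an open set on which the Frenet equations hold, `Π₊ⁱP₀` is orthogonal to the jets of
`Π₊ⁿP₀` of order less than `n - i`. -/
theorem FrenetOn.mul_jet {P₀ : ℂ → Mat N} {n : ℕ} {U : Set ℂ} (hF : FrenetOn P₀ n U)
    (h₀ : IsFiniteActionSolution P₀) (hn : n ≤ N) (hP : IsFiniteActionSolution (raising^[n] P₀))
    {m : ℕ} : ∀ {i : ℕ}, i + m < n → ∀ ξ ∈ U, raising^[i] P₀ ξ * jet (raising^[n] P₀) m ξ = 0 := by
  induction m with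
  | zero =>
    intro i hi ξ hξ
    exact mul_eq_zero_comm_of_hermitian (h₀.iterate_raising_conjTranspose _ _)
      (h₀.iterate_raising_conjTranspose _ _) (hF.orth i n (by omega) le_rfl ξ hξ)
  | succ m ih =>
    intro i hi ξ hξ
    have hx := h₀.iterate_raising_conjTranspose i
    have dx : DifferentiableAt ℝ (raising^[i] P₀) ξ :=
      (hF.contDiffAt i (by omega) ξ hξ).differentiableAt
        (by exact_mod_cast (by omega : N + 2 - i ≠ 0))
    have hl := dMinus_leibniz (ξ := ξ) (X := raising^[i] P₀)
      (by filter_upwards [hF.isOpen.mem_nhds hξ] with η hη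
          using hF.isProjector i (by omega) η hη) dx
    have hup := congrArg Matrix.conjTranspose (hF.up i (by omega) ξ hξ)
    rw [Matrix.conjTranspose_mul, Matrix.conjTranspose_mul, hx,
      conjTranspose_dPlus (Filter.Eventually.of_forall hx),
      h₀.iterate_raising_conjTranspose (i + 1)] at hup
    -- Write `∂₋x = ∂₋x x + x ∂₋x`; the adjoint of the upward equation makes the second term factor
    -- through the next projector, so induction at `i` and `i + 1` applies.
    have h1 : dMinus (raising^[i] P₀) ξ * jet (raising^[n] P₀) m ξ = 0 := by
      rw [← hl, ← hup, add_mul, mul_assoc, ih (by omega) ξ hξ, mul_zero, zero_add, mul_assoc,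
        ih (by omega) ξ hξ, mul_zero]
    have h2 := dMinus_mul dx (hP.differentiable_jet (m := m) (by omega) ξ)
    rw [dMinus_congr (g := fun _ => 0) (by
      filter_upwards [hF.isOpen.mem_nhds hξ] with η hη using ih (by omega) η hη), dMinus_const,
      h1, zero_add] at h2
    rw [jet_succ, ← mul_assoc, ← h2, zero_mul]

/-- The Frenet equations hold only near a dense set of points, and intermediate iterates need not be
continuous. Hence only `P₀` is treated by density, and the others are reached from it by raising. -/
theorem IsFiniteActionSolution.iterate_raising_mul_jet_of_lt {P₀ : ℂ → Mat N} {n : ℕ}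
    (h₀ : IsFiniteActionSolution P₀) (hP : IsFiniteActionSolution (raising^[n] P₀)) {i : ℕ} :
    ∀ {m : ℕ}, i + m < n → ∀ ξ, raising^[i] P₀ ξ * jet (raising^[n] P₀) m ξ = 0 := by
  have hne : ∀ ξ, raising^[n] P₀ ξ ≠ 0 := fun ξ h0 => by
    have := (hP.isProjector ξ).2.2
    simp [h0] at this
  have hn : n ≤ N := by
    by_contra hn
    exact hne 0 (by rw [h₀.iterate_raising_eq_zero_of_lt (not_le.1 hn)]; rfl)
  induction i with
  | zero =>
    intro m hm ξ
    have hc : IsClosed {ξ | P₀ ξ * jet (raising^[n] P₀) m ξ = 0} :=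
      isClosed_eq (h₀.differentiable.continuous.mul
        (hP.differentiable_jet (m := m) (by omega)).continuous) continuous_const
    have hd : Dense {ξ | P₀ ξ * jet (raising^[n] P₀) m ξ = 0} := by
      refine dense_iff_inter_open.2 fun U hU hUn => ?_
      obtain ⟨V, hVU, ⟨η, hη⟩, hF⟩ := h₀.exists_frenetOn hn hU hUn
        fun W _ _ ⟨ζ, hζ⟩ => ⟨ζ, hζ, hne ζ⟩
      exact ⟨η, hVU hη, hF.mul_jet h₀ hn hP hm η hη⟩
    exact hc.closure_subset (hd ξ)
  | succ i ih =>
    intro m hm ξ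
    rw [Function.iterate_succ_apply']
    have hd := hP.differentiable_jet (m := m) (by omega)
    exact raising_mul_eq_zero hd (ih (by omega)) (fun η => mul_dMinus_jet hP.mul_self
      hP.differentiable hd (ih (by omega) η) (ih (by omega) η)) ξ

theorem IsFiniteActionSolution.commute_of_mem_projectorSequence (hP : IsFiniteActionSolution P)
    {Q : ℂ → Mat N} (hQ : Q ∈ projectorSequence P) (ξ : ℂ) : Commute (Q ξ) (P ξ) := by
  obtain ⟨P₀, n, j, h₀, -, rfl, rfl, -⟩ := hQ
  rcases Nat.lt_or_ge j n with h | h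
  · have h1 : raising^[j] P₀ ξ * raising^[n] P₀ ξ = 0 :=
      h₀.iterate_raising_mul_jet_of_lt hP (m := 0) (by omega) ξ
    rw [Commute, SemiconjBy, h1, mul_eq_zero_comm_of_hermitian
      (h₀.iterate_raising_conjTranspose _ _) (hP.conjTranspose ξ) h1]
  · obtain ⟨i, rfl⟩ : ∃ i, j = i + n := ⟨j - n, by omega⟩
    rw [Function.iterate_add_apply]
    exact hP.commute_iterate_raising i ξ

end Vanishing

/-! ### Geometry of the surface. -/

section Surface

variable {N : ℕ} {P F : ℂ → Mat N}

theorem trace_comm_mul {A p C : Mat N} (h : Commute C p) : (comm A p * C).trace = 0 := by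
  rw [comm, sub_mul, Matrix.trace_sub, mul_assoc, ← h.eq, mul_assoc p, Matrix.trace_mul_comm p,
    mul_assoc, sub_self]

theorem form_comm_left {A p C : Mat N} (h : Commute C p) : form (comm A p) C = 0 := by
  rw [form, trace_comm_mul h, mul_zero]

theorem form_comm_right {A p C : Mat N} (h : Commute C p) : form C (comm A p) = 0 := by
  rw [form, Matrix.trace_mul_comm, trace_comm_mul h, mul_zero]

theorem smul_comm_eq (c : ℂ) (A p : Mat N) : c • comm A p = comm (c • A) p := by
  simp only [comm, smul_sub, smul_mul_assoc, mul_smul_comm]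

theorem comm_sub (A B p : Mat N) : comm A p - comm B p = comm (A - B) p := by
  simp only [comm, sub_mul, mul_sub]; abel

/-- With the reflection `r = 2p - 1`, off-diagonality gives `[a, p] = a r` and `[b, p] = -r b`, and
`r² = 1`. So the metric of `F` can be read off from `P`. -/
theorem trace_comm_mul_comm {p a b : Mat N} (hp : p * p = p) (ha : a * p + p * a = a)
    (hb : b * p + p * b = b) : (comm a p * comm b p).trace = -(a * b).trace := by
  have h1 := mul_mul_eq_zero_of_leibniz hp ha
  have h2 := mul_mul_eq_zero_of_leibniz hp hb
  have e : comm a p * comm b p + a * b =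
      a * (p * b * p) + (p * a * p) * b + (a * b - a * (p * p) * b - p * (a * b) * p) := by
    simp only [comm, mul_sub, sub_mul, mul_assoc]; abel
  have h3 : a * b - a * p * b = p * a * b := by
    rw [← sub_mul, sub_eq_of_eq_add' ha.symm]
  have h4 : (p * (a * b) * p).trace = (p * a * b).trace := by
    rw [Matrix.trace_mul_comm, ← mul_assoc, hp, ← mul_assoc]
  rw [eq_neg_iff_add_eq_zero, ← Matrix.trace_add, e, h1, h2, mul_zero, zero_mul, hp, h3,
    Matrix.trace_add, Matrix.trace_sub, h4]
  simp

namespace IsFiniteActionSolution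

variable (hP : IsFiniteActionSolution P)
include hP

/-- Isotropy of order one kills `P ∂₋P ∂₋P P`, and an off-diagonal square has equal traces on the
two diagonal blocks. -/
theorem trace_dMinus_sq (ξ : ℂ) : (dMinus P ξ * dMinus P ξ).trace = 0 := by
  have h := hP.isotropy (m := 1) (by omega) ξ
  rw [jet_succ, jet_zero, ← mul_assoc] at h
  have h1 : (P ξ * (dMinus P ξ * dMinus P ξ)).trace = 0 := by
    rw [← hP.mul_self ξ, mul_assoc, Matrix.trace_mul_comm, ← mul_assoc, h, Matrix.trace_zero]
  have h2 : (dMinus P ξ * P ξ * dMinus P ξ).trace = 0 := by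
    rw [Matrix.trace_mul_comm, ← mul_assoc, Matrix.trace_mul_comm, h1]
  calc (dMinus P ξ * dMinus P ξ).trace
      = ((dMinus P ξ * P ξ + P ξ * dMinus P ξ) * dMinus P ξ).trace := by rw [hP.dMinus_leibniz]
    _ = 0 := by rw [add_mul, Matrix.trace_add, h2, mul_assoc, h1, add_zero]

/-- Conformality of the immersion. -/
theorem trace_dPlus_sq (ξ : ℂ) : (dPlus P ξ * dPlus P ξ).trace = 0 := by
  rw [← hP.conjTranspose_dMinus, ← Matrix.conjTranspose_mul, Matrix.trace_conjTranspose,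
    hP.trace_dMinus_sq, star_zero]

theorem differentiable_dPlus : Differentiable ℝ (dPlus P) :=
  (contDiff_dPlus (hP.contDiff_of_le (k := 2) (by omega)) (m := 1) le_rfl).differentiable
    (by norm_num)

theorem differentiable_dMinus : Differentiable ℝ (dMinus P) :=
  (contDiff_dMinus (hP.contDiff_of_le (k := 2) (by omega)) (m := 1) le_rfl).differentiable
    (by norm_num)

end IsFiniteActionSolution

namespace IsSurface

variable (hF : IsSurface P F) (hP : IsFiniteActionSolution P)
include hF hP

theorem differentiable_dPlus : Differentiable ℝ (dPlus F) := by
  rw [funext hF.dPlus_eq]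
  exact fun ξ => (((hP.differentiable_dPlus ξ).mul (hP.differentiable ξ)).sub
    ((hP.differentiable ξ).mul (hP.differentiable_dPlus ξ))).const_smul (-Complex.I)

theorem differentiable_dMinus : Differentiable ℝ (dMinus F) := by
  rw [funext hF.dMinus_eq]
  exact fun ξ => (((hP.differentiable_dMinus ξ).mul (hP.differentiable ξ)).sub
    ((hP.differentiable ξ).mul (hP.differentiable_dMinus ξ))).const_smul Complex.I

/-- The terms `∂₊P ∂₊P` cancel, so the second derivative is again a commutator with `P`. -/
theorem dPlus_dPlus (ξ : ℂ) :
    dPlus (dPlus F) ξ = -Complex.I • comm (dPlus (dPlus P) ξ) (P ξ) := by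
  have h1 := hP.differentiable ξ
  have h2 := hP.differentiable_dPlus ξ
  rw [funext hF.dPlus_eq]
  unfold comm
  rw [dPlus_const_smul _ ((h2.fun_mul h1).fun_sub (h1.fun_mul h2)),
    dPlus_sub (h2.fun_mul h1) (h1.fun_mul h2), dPlus_mul h2 h1, dPlus_mul h1 h2]
  congr 1
  abel

theorem dMinus_dMinus (ξ : ℂ) :
    dMinus (dMinus F) ξ = Complex.I • comm (dMinus (dMinus P) ξ) (P ξ) := by
  have h1 := hP.differentiable ξ
  have h2 := hP.differentiable_dMinus ξ
  rw [funext hF.dMinus_eq]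
  unfold comm
  rw [dMinus_const_smul _ ((h2.fun_mul h1).fun_sub (h1.fun_mul h2)),
    dMinus_sub (h2.fun_mul h1) (h1.fun_mul h2), dMinus_mul h2 h1, dMinus_mul h1 h2]
  congr 1
  abel

theorem normalPM_eq (ξ : ℂ) :
    normalPM F ξ = Complex.I • (dMinus P ξ * dPlus P ξ - dPlus P ξ * dMinus P ξ) := by
  have h1 := hP.differentiable ξ
  have h2 := hP.differentiable_dMinus ξ
  rw [normalPM, funext hF.dMinus_eq]
  unfold comm
  rw [dPlus_const_smul _ ((h2.fun_mul h1).fun_sub (h1.fun_mul h2)),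
    dPlus_sub (h2.fun_mul h1) (h1.fun_mul h2), dPlus_mul h2 h1, dPlus_mul h1 h2,
    hP.dPlus_dMinus_mul]
  congr 1
  abel

/-- Harmonicity, the integrability condition of `dF`, gives the symmetry of the mixed derivatives
directly. -/
theorem dMinus_dPlus (ξ : ℂ) : dMinus (dPlus F) ξ = normalPM F ξ := by
  have h1 := hP.differentiable ξ
  have h2 := hP.differentiable_dPlus ξ
  rw [hF.normalPM_eq hP, funext hF.dPlus_eq]
  unfold comm
  rw [dMinus_const_smul _ ((h2.fun_mul h1).fun_sub (h1.fun_mul h2)),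
    dMinus_sub (h2.fun_mul h1) (h1.fun_mul h2), dMinus_mul h2 h1, dMinus_mul h1 h2,
    ← hP.dPlus_dMinus_comm, hP.dPlus_dMinus_mul, neg_smul, ← smul_neg]
  congr 1
  abel

theorem commute_normalPM (ξ : ℂ) : Commute (normalPM F ξ) (P ξ) := by
  rw [hF.normalPM_eq hP]
  refine Commute.smul_left (Commute.sub_left ?_ ?_) _
  · exact mul_mul_comm_of_leibniz (hP.dMinus_leibniz ξ) (hP.dPlus_leibniz ξ)
  · exact mul_mul_comm_of_leibniz (hP.dPlus_leibniz ξ) (hP.dMinus_leibniz ξ)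

omit hP in
theorem dPlus_eq_comm (ξ : ℂ) : dPlus F ξ = comm (-Complex.I • dPlus P ξ) (P ξ) := by
  rw [hF.dPlus_eq, smul_comm_eq]

omit hP in
theorem dMinus_eq_comm (ξ : ℂ) : dMinus F ξ = comm (Complex.I • dMinus P ξ) (P ξ) := by
  rw [hF.dMinus_eq, smul_comm_eq]

theorem normalPP_eq_comm (ξ : ℂ) : ∃ A, normalPP P F ξ = comm A (P ξ) := by
  rw [normalPP, hF.dPlus_dPlus hP, hF.dPlus_eq, smul_comm_eq, smul_comm_eq, smul_comm_eq, comm_sub]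
  exact ⟨_, rfl⟩

theorem normalMM_eq_comm (ξ : ℂ) : ∃ A, normalMM P F ξ = comm A (P ξ) := by
  rw [normalMM, hF.dMinus_dMinus hP, hF.dMinus_eq, smul_comm_eq, smul_comm_eq, smul_comm_eq,
    comm_sub]
  exact ⟨_, rfl⟩

theorem trace_dPlus_mul_dPlus (ξ : ℂ) : (dPlus F ξ * dPlus F ξ).trace = 0 := by
  rw [hF.dPlus_eq, smul_mul_smul_comm, Matrix.trace_smul,
    trace_comm_mul_comm (hP.mul_self ξ) (hP.dPlus_leibniz ξ) (hP.dPlus_leibniz ξ),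
    hP.trace_dPlus_sq, neg_zero, smul_zero]

theorem trace_dMinus_mul_dMinus (ξ : ℂ) : (dMinus F ξ * dMinus F ξ).trace = 0 := by
  rw [hF.dMinus_eq, smul_mul_smul_comm, Matrix.trace_smul,
    trace_comm_mul_comm (hP.mul_self ξ) (hP.dMinus_leibniz ξ) (hP.dMinus_leibniz ξ),
    hP.trace_dMinus_sq, neg_zero, smul_zero]

theorem trace_dPlus_mul_dMinus (ξ : ℂ) : (dPlus F ξ * dMinus F ξ).trace = -lagrangian P ξ := by
  rw [hF.dPlus_eq, hF.dMinus_eq, smul_mul_smul_comm, Matrix.trace_smul,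
    trace_comm_mul_comm (hP.mul_self ξ) (hP.dPlus_leibniz ξ) (hP.dMinus_leibniz ξ), lagrangian]
  simp

theorem trace_dPlus_dPlus_mul_dPlus (ξ : ℂ) : (dPlus (dPlus F) ξ * dPlus F ξ).trace = 0 := by
  have hd := hF.differentiable_dPlus hP ξ
  have h := dPlus_trace (hd.fun_mul hd)
  rw [funext (hF.trace_dPlus_mul_dPlus hP), dPlus_const, dPlus_mul hd hd, Matrix.trace_add,
    Matrix.trace_mul_comm (dPlus F ξ)] at h
  exact self_eq_neg.1 (eq_neg_of_add_eq_zero_left h.symm)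

theorem trace_dMinus_dMinus_mul_dMinus (ξ : ℂ) :
    (dMinus (dMinus F) ξ * dMinus F ξ).trace = 0 := by
  have hd := hF.differentiable_dMinus hP ξ
  have h := dMinus_trace (hd.fun_mul hd)
  rw [funext (hF.trace_dMinus_mul_dMinus hP), dMinus_const, dMinus_mul hd hd, Matrix.trace_add,
    Matrix.trace_mul_comm (dMinus F ξ)] at h
  exact self_eq_neg.1 (eq_neg_of_add_eq_zero_left h.symm)

theorem trace_normalPM_mul_dMinus (ξ : ℂ) : (normalPM F ξ * dMinus F ξ).trace = 0 := by
  rw [Matrix.trace_mul_comm, hF.dMinus_eq_comm, trace_comm_mul (hF.commute_normalPM hP ξ)]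

theorem trace_dPlus_mul_normalPM (ξ : ℂ) : (dPlus F ξ * normalPM F ξ).trace = 0 := by
  rw [hF.dPlus_eq_comm, trace_comm_mul (hF.commute_normalPM hP ξ)]

/-- Differentiate `tr(∂₊F ∂₋F) = -L`; the term with `N₊₋` drops out. This is what makes `∂₊L / L`
the right coefficient in `N₊₊`. -/
theorem trace_dPlus_dPlus_mul_dMinus (ξ : ℂ) :
    (dPlus (dPlus F) ξ * dMinus F ξ).trace = -dPlus (lagrangian P) ξ := by
  have hp := hF.differentiable_dPlus hP ξ
  have hm := hF.differentiable_dMinus hP ξ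
  have h := dPlus_trace (hp.fun_mul hm)
  have hL : DifferentiableAt ℝ (lagrangian P) ξ :=
    ((traceCLM N).restrictScalars ℝ).differentiableAt.comp ξ
    ((hP.differentiable_dPlus ξ).fun_mul (hP.differentiable_dMinus ξ))
  have h0 := hF.trace_dPlus_mul_normalPM hP ξ
  rw [normalPM] at h0
  rw [dPlus_mul hp hm, Matrix.trace_add, h0, add_zero] at h
  rw [← h, funext (hF.trace_dPlus_mul_dMinus hP)]
  simpa using dPlus_const_smul (-1) hL

theorem trace_dMinus_dMinus_mul_dPlus (ξ : ℂ) :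
    (dMinus (dMinus F) ξ * dPlus F ξ).trace = -dMinus (lagrangian P) ξ := by
  have hp := hF.differentiable_dPlus hP ξ
  have hm := hF.differentiable_dMinus hP ξ
  have h := dMinus_trace (hp.fun_mul hm)
  have hL : DifferentiableAt ℝ (lagrangian P) ξ :=
    ((traceCLM N).restrictScalars ℝ).differentiableAt.comp ξ
    ((hP.differentiable_dPlus ξ).fun_mul (hP.differentiable_dMinus ξ))
  rw [dMinus_mul hp hm, Matrix.trace_add, hF.dMinus_dPlus hP, hF.trace_normalPM_mul_dMinus hP,
    zero_add, Matrix.trace_mul_comm] at h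
  rw [← h, funext (hF.trace_dPlus_mul_dMinus hP)]
  simpa using dMinus_const_smul (-1) hL

/-- The Laplacian is `4 ∂₊∂₋`: the pure second derivatives cancel between the two directions. -/
theorem meanCurvature_eq (ξ : ℂ) :
    meanCurvature P F ξ = (4 / lagrangian P ξ) • normalPM F ξ := by
  have hp := hF.differentiable_dPlus hP ξ
  have hm := hF.differentiable_dMinus hP ξ
  have h1 : d1 (d1 F) ξ = dPlus (dPlus F) ξ + dMinus (dMinus F) ξ + (2 : ℂ) • normalPM F ξ := by
    rw [d1_eq, show d1 F = fun η => dPlus F η + dMinus F η from funext (d1_eq F),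
      dPlus_add hp hm, dMinus_add hp hm, hF.dMinus_dPlus hP, normalPM]
    module
  have h2 : d2 (d2 F) ξ =
      -(dPlus (dPlus F) ξ + dMinus (dMinus F) ξ) + (2 : ℂ) • normalPM F ξ := by
    rw [d2_eq, show d2 F = fun η => Complex.I • (dPlus F η - dMinus F η) from funext (d2_eq F),
      dPlus_const_smul _ (hp.fun_sub hm), dMinus_const_smul _ (hp.fun_sub hm),
      dPlus_sub hp hm, dMinus_sub hp hm, hF.dMinus_dPlus hP, ← smul_sub, smul_smul,
      Complex.I_mul_I, normalPM]
    module
  rw [meanCurvature, h1, h2, div_eq_mul_inv]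
  module

end IsSurface

end Surface

end CPModel

end

/-! ### Assembly of the theorem. -/

theorem mainTheorem6 {N : ℕ} (P F : ℂ → CPModel.Mat N)
    (hP : CPModel.IsFiniteActionSolution P) (hF : CPModel.IsSurface P F) :
    (∀ ξ : ℂ, CPModel.form (CPModel.normalPM F ξ) (CPModel.dPlus F ξ) = 0 ∧
      CPModel.form (CPModel.normalPM F ξ) (CPModel.dMinus F ξ) = 0) ∧
    (∀ ξ : ℂ, CPModel.lagrangian P ξ ≠ 0 →
      CPModel.form (CPModel.normalPP P F ξ) (CPModel.dPlus F ξ) = 0 ∧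
      CPModel.form (CPModel.normalPP P F ξ) (CPModel.dMinus F ξ) = 0 ∧
      CPModel.form (CPModel.normalMM P F ξ) (CPModel.dPlus F ξ) = 0 ∧
      CPModel.form (CPModel.normalMM P F ξ) (CPModel.dMinus F ξ) = 0 ∧
      CPModel.meanCurvature P F ξ = (4 / CPModel.lagrangian P ξ) • CPModel.normalPM F ξ ∧
      CPModel.form (CPModel.meanCurvature P F ξ) (CPModel.dPlus F ξ) = 0 ∧
      CPModel.form (CPModel.meanCurvature P F ξ) (CPModel.dMinus F ξ) = 0 ∧
      CPModel.form (CPModel.normalPP P F ξ) (CPModel.normalPM F ξ) = 0 ∧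
      CPModel.form (CPModel.normalMM P F ξ) (CPModel.normalPM F ξ) = 0) ∧
    (∀ Q : ℂ → CPModel.Mat N,
      (Q ∈ CPModel.projectorSequence P ∨
        ∃ k : ℕ, Q = CPModel.raising^[k] P ∨ Q = CPModel.lowering^[k] P) →
      (∀ ξ : ℂ, CPModel.form (Q ξ) (CPModel.dPlus F ξ) = 0 ∧
        CPModel.form (Q ξ) (CPModel.dMinus F ξ) = 0) ∧
      (∀ ξ : ℂ, CPModel.lagrangian P ξ ≠ 0 →
        CPModel.form (CPModel.normalPP P F ξ) (Q ξ) = 0 ∧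
        CPModel.form (CPModel.normalMM P F ξ) (Q ξ) = 0)) := by
  have hpm := hF.commute_normalPM hP
  -- Anything commuting with `P` is normal to the surface; this serves `N₊₋`, `H` and all the `Q`
  -- alike.
  have tangent {Q : CPModel.Mat N} {ξ : ℂ} (hQ : Commute Q (P ξ)) :
      CPModel.form Q (CPModel.dPlus F ξ) = 0 ∧ CPModel.form Q (CPModel.dMinus F ξ) = 0 := by
    rw [hF.dPlus_eq_comm, hF.dMinus_eq_comm]
    exact ⟨CPModel.form_comm_right hQ, CPModel.form_comm_right hQ⟩
  have normal {Q : CPModel.Mat N} {ξ : ℂ} (hQ : Commute Q (P ξ)) :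
      CPModel.form (CPModel.normalPP P F ξ) Q = 0 ∧ CPModel.form (CPModel.normalMM P F ξ) Q = 0 := by
    obtain ⟨A, hA⟩ := hF.normalPP_eq_comm hP ξ
    obtain ⟨B, hB⟩ := hF.normalMM_eq_comm hP ξ
    rw [hA, hB]
    exact ⟨CPModel.form_comm_left hQ, CPModel.form_comm_left hQ⟩
  refine ⟨fun ξ => tangent (hpm ξ), fun ξ hL => ?_, fun Q hQ => ?_⟩
  · have hH := hF.meanCurvature_eq hP ξ
    have hHt := tangent (hH ▸ (hpm ξ).smul_left (4 / CPModel.lagrangian P ξ))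
    have hN := normal (hpm ξ)
    refine ⟨?_, ?_, ?_, ?_, hH, hHt.1, hHt.2, hN.1, hN.2⟩
    · rw [CPModel.form, CPModel.normalPP, sub_mul, smul_mul_assoc, Matrix.trace_sub,
        Matrix.trace_smul, hF.trace_dPlus_dPlus_mul_dPlus hP, hF.trace_dPlus_mul_dPlus hP]
      simp
    · rw [CPModel.form, CPModel.normalPP, sub_mul, smul_mul_assoc, Matrix.trace_sub,
        Matrix.trace_smul, hF.trace_dPlus_dPlus_mul_dMinus hP, hF.trace_dPlus_mul_dMinus hP, CPModel.christoffelPlus,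
        smul_eq_mul, mul_neg, div_mul_cancel₀ _ hL, sub_self, mul_zero]
    · rw [CPModel.form, CPModel.normalMM, sub_mul, smul_mul_assoc, Matrix.trace_sub,
        Matrix.trace_smul, hF.trace_dMinus_dMinus_mul_dPlus hP, Matrix.trace_mul_comm (CPModel.dMinus F ξ),
        hF.trace_dPlus_mul_dMinus hP, CPModel.christoffelMinus,
        smul_eq_mul, mul_neg, div_mul_cancel₀ _ hL, sub_self, mul_zero]
    · rw [CPModel.form, CPModel.normalMM, sub_mul, smul_mul_assoc, Matrix.trace_sub,
        Matrix.trace_smul, hF.trace_dMinus_dMinus_mul_dMinus hP, hF.trace_dMinus_mul_dMinus hP]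
      simp
  · have hc : ∀ ξ, Commute (Q ξ) (P ξ) := by
      rcases hQ with hQ | ⟨k, rfl | rfl⟩
      · exact hP.commute_of_mem_projectorSequence hQ
      · exact hP.commute_iterate_raising k
      · exact hP.commute_iterate_lowering k
    exact ⟨fun ξ => tangent (hc ξ), fun ξ _ => normal (hc ξ)⟩
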